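/- Let $d\ge 2$ be an integer. For a finite set $\mathcal X\subset\mathbb R^d$ whose points have distinct $d$-th coordinates, the South minimal directed spanning tree (MDST) joins each point $x\in\mathcal X$, other than the one with the smallest $d$-th coordinate, by an edge to a Euclidean-nearest point among the points of $\mathcal X\setminus\{x\}$ whose $d$-th coordinate is at most that of $x$; let $\mathcal L^d_{\max}(\mathcal X)$ be the length of its longest edge. For a finite sequence $(y_1,\dots,y_m)$ in $\mathbb R^{d-1}$, the on-line nearest-neighbour graph (ONG) joins each $y_i$, $2\le i\le m$, to a nearest point among $y_1,\dots,y_{i-1}$; let $$\mathcal O^{d-1}_{\max}(y_1,\dots,y_m)=\max_{2\le i\le m}\ \min_{1\le j<i}\|y_i-y_j\|$$ be the length of its longest edge. (A longest edge length is $0$ if there are no edges.) The max-Dickman distribution is the law of a real random variable $M$ satisfying $M\overset{d}{=}\max\{1-U,UM\}$, where $U$ is uniform on $(0,1)$ and independent of the $M$ on the right; exactly one probability law on $\mathbb R$ has this property. There exists a random variable $Q_{\max}(d-1)$, whose law depends only on $d$, such that the following hold. 1. If $\mathcal P_n$ is a homogeneous Poisson point process of intensity $n$ on $(0,1)^d$,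 then $\mathcal L^d_{\max}(\mathcal P_n)\overset{d}{\longrightarrow}Q_{\max}(d-1)$ as $n\to\infty$. 2. $Q_{\max}(d-1)$ is the limit of the longest edge of the ONG in dimension $d-1$: if $U_1,U_2,\dots$ are independent uniform random vectors in $(0,1)^{d-1}$ and $N(n)$ is a Poisson random variable with mean $n$, independent of $(U_1,U_2,\dots)$, then, as $n\to\infty$, $\mathcal O^{d-1}_{\max}(U_1,\dots,U_n)\overset{d}{\longrightarrow}Q_{\max}(d-1)$ and $\mathcal O^{d-1}_{\max}(U_1,\dots,U_{N(n)})\overset{d}{\longrightarrow}Q_{\max}(d-1)$. 3. If $d=2$, then $Q_{\max}(1)\overset{d}{=}\max\{UM_1,(1-U)M_2\}$, where $U,M_1,M_2$ are independent, $U$ is uniform on $(0,1)$, and $M_1,M_2$ have the max-Dickman distribution. -/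

import Mathlib

open MeasureTheory ProbabilityTheory Filter Topology
open scoped NNReal ENNReal

namespace SouthMDST

/-- The open unit cube `(0,1)^d`. -/
def openCube (d : ℕ) : Set (EuclideanSpace ℝ (Fin d)) :=
  {x | ∀ i, x i ∈ Set.Ioo (0 : ℝ) 1}

/-- The uniform distribution on `(0,1)^d`: Lebesgue measure restricted to the open unit cube,
which has total mass `1`. -/
noncomputable def uniformCube (d : ℕ) : Measure (EuclideanSpace ℝ (Fin d)) :=
  volume.restrict (openCube d)

/-- The uniform distribution on `(0,1)`. -/
noncomputable def uniform01 : Measure ℝ := volume.restrict (Set.Ioo (0 : ℝ) 1)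

/-- The number of points of the finite set `X` that lie in `A`. -/
noncomputable def count {E : Type*} (X : Finset E) (A : Set E) : ℕ :=
  ((X : Set E) ∩ A).ncard

/-- `P` is a homogeneous Poisson point process of intensity `r` on `(0,1)^d`: a random finite
subset of the cube such that the number of points in a Borel set `A` is Poisson distributed with
mean `r` times the volume of `A ∩ (0,1)^d`, and the numbers of points in finitely many pairwise
disjoint Borel sets are independent. -/
structure IsPoissonProcess {d : ℕ} (r : ℝ≥0) {Ω : Type*} [MeasurableSpace Ω]
    (P : Ω → Finset (EuclideanSpace ℝ (Fin d))) (μ : Measure Ω) : Prop where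
  subset_cube : ∀ ω, (P ω : Set (EuclideanSpace ℝ (Fin d))) ⊆ openCube d
  measurable_count : ∀ A, MeasurableSet A → Measurable fun ω => count (P ω) A
  map_count : ∀ A, MeasurableSet A →
    μ.map (fun ω => count (P ω) A) = poissonMeasure (r * (uniformCube d A).toNNReal)
  indep_count : ∀ (m : ℕ) (A : Fin m → Set (EuclideanSpace ℝ (Fin d))),
    (∀ i, MeasurableSet (A i)) → Pairwise (fun i j => Disjoint (A i) (A j)) →
      iIndepFun (fun i ω => count (P ω) (A i)) μ

open scoped Classical in
/-- The points of `X` other than `x` that precede `x` in the South order, i.e. whose last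
coordinate is at most that of `x`. The ambient dimension is `k + 1`. -/
noncomputable def southPreds {k : ℕ} (X : Finset (EuclideanSpace ℝ (Fin (k + 1))))
    (x : EuclideanSpace ℝ (Fin (k + 1))) : Finset (EuclideanSpace ℝ (Fin (k + 1))) :=
  X.filter fun z => z ≠ x ∧ z (Fin.last k) ≤ x (Fin.last k)

open scoped Classical in
/-- The length of the edge of the South minimal directed spanning tree on `X` that leaves `x`: the
Euclidean distance from `x` to a directed nearest neighbour, and `0` if `x` is the sink. -/
noncomputable def southDist {k : ℕ} (X : Finset (EuclideanSpace ℝ (Fin (k + 1))))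
    (x : EuclideanSpace ℝ (Fin (k + 1))) : ℝ :=
  if h : (southPreds X x).Nonempty then (southPreds X x).inf' h fun z => ‖z - x‖ else 0

open scoped Classical in
/-- The length of the longest edge of the South minimal directed spanning tree on `X`
(`0` if there is no edge). -/
noncomputable def southLongestEdge {k : ℕ} (X : Finset (EuclideanSpace ℝ (Fin (k + 1)))) : ℝ :=
  if h : X.Nonempty then X.sup' h (southDist X) else 0

open scoped Classical in
/-- The length of the edge of the on-line nearest-neighbour graph on the sequence
`y 0, y 1, …` that leaves `y i`: the distance from `y i` to the nearest of `y 0, …, y (i - 1)`, and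
`0` if `i = 0`. -/
noncomputable def ongDist {d : ℕ} (y : ℕ → EuclideanSpace ℝ (Fin d)) (i : ℕ) : ℝ :=
  if h : (Finset.range i).Nonempty then (Finset.range i).inf' h fun j => ‖y i - y j‖ else 0

open scoped Classical in
/-- The length of the longest edge of the on-line nearest-neighbour graph on the sequence
`y 0, …, y (m - 1)` of `m` points (`0` if there is no edge). -/
noncomputable def ongLongestEdge {d : ℕ} (y : ℕ → EuclideanSpace ℝ (Fin d)) (m : ℕ) : ℝ :=
  if h : (Finset.range m).Nonempty then (Finset.range m).sup' h (ongDist y) else 0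

/-- `D` is a max-Dickman distribution: if `M` has law `D` and `U` is uniform on `(0,1)` and
independent of `M`, then `max {1 - U, U M}` again has law `D`. -/
def IsMaxDickman (D : ProbabilityMeasure ℝ) : Prop :=
  (uniform01.prod (D : Measure ℝ)).map (fun p : ℝ × ℝ => max (1 - p.1) (p.1 * p.2)) =
    (D : Measure ℝ)

end SouthMDST

/-! The common limit is the law of `ongSup`, the supremum of all edge lengths of the on-line graph
on an infinite i.i.d. uniform sequence. The longest edge on the first n points is monotone in n and
bounded on the cube, so it converges almost surely to `ongSup`. A Poisson number of points gives the
same limit, because as its mean grows it leaves every finite set of indices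
(`tendsto_integral_poissonMeasure`).

For the South tree, realise the Poisson process as a Poisson number of points with independent
uniform heights and projections. Ranking by height uses the heights alone, so the ranked projections
are again i.i.d. uniform. The South longest edge dominates the on-line longest edge of these
projections. It exceeds it by at most O(1/M) once every cell of a grid of mesh 1/(M+1) is occupied:
a high point then has a lower point nearby, while among the low points height differences are
negligible (`abs_southLongestEdge_sub_ongLongestEdge_le`). Every Poisson process has the same
avoidance probabilities as this realisation, and these determine the law of the longest edge
(Rényi's principle, `map_southLongestEdge_eq`).

On the line, an arrival between the current extremes is never farther from its predecessors than the
longest edge so far, so only records matter. With a the minimum, b the maximum, M max-Dickman and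
H(s) = P(s M ≤ t), the quantity 1{no edge exceeds t} H(a) H(1 - b) has constant mean, by the
fixed-point equation for M (`IsMaxDickman.integral_step`). At the first point this mean is P(max{U
M₁, (1 - U) M₂} ≤ t). In the limit a → 0 and 1 - b → 0, and the mean becomes P(`ongSup` ≤ t).

The max-Dickman law exists and is unique because iterating the recursion with the fresh uniform
innermost converges pathwise and forgets its starting value at the rate of a product of uniforms. -/

namespace SouthMDST


/-! ### Deterministic bounds: edge lengths and their perturbation -/

section Deterministic

theorem southDist_nonneg {k : ℕ} (X : Finset (EuclideanSpace ℝ (Fin (k + 1))))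
    (x : EuclideanSpace ℝ (Fin (k + 1))) : 0 ≤ southDist X x := by
  unfold southDist
  split_ifs with h
  · exact Finset.le_inf' _ _ fun z _ => norm_nonneg _
  · exact le_rfl

theorem southDist_le_iff {k : ℕ} (X : Finset (EuclideanSpace ℝ (Fin (k + 1))))
    (x : EuclideanSpace ℝ (Fin (k + 1))) {t : ℝ} (ht : 0 ≤ t) :
    southDist X x ≤ t ↔ ((∃ z ∈ X, z ≠ x ∧ z (Fin.last k) ≤ x (Fin.last k)) →
      ∃ z ∈ X, z ≠ x ∧ z (Fin.last k) ≤ x (Fin.last k) ∧ ‖z - x‖ ≤ t) := by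
  unfold southDist
  split_ifs with h
  · rw [Finset.inf'_le_iff]
    obtain ⟨z, hz⟩ := h
    simp only [southPreds, Finset.mem_filter] at hz ⊢
    constructor
    · rintro ⟨i, hi, h⟩ _
      exact ⟨i, hi.1, hi.2.1, hi.2.2, h⟩
    · intro h
      obtain ⟨w, h1, h2, h3, h4⟩ := h ⟨z, hz.1, hz.2⟩
      exact ⟨w, ⟨h1, h2, h3⟩, h4⟩
  -- At the sink the length is 0 by convention, which is where 0 ≤ t enters.
  · simp only [ht, true_iff]
    rintro ⟨z, hz⟩
    exact absurd ⟨z, by simpa [southPreds] using hz⟩ h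

theorem southLongestEdge_nonneg {k : ℕ} (X : Finset (EuclideanSpace ℝ (Fin (k + 1)))) :
    0 ≤ southLongestEdge X := by
  unfold southLongestEdge
  split_ifs with h
  · obtain ⟨x, hx⟩ := h
    exact (southDist_nonneg X x).trans (Finset.le_sup' _ hx)
  · exact le_rfl

theorem southLongestEdge_le_iff {k : ℕ} (X : Finset (EuclideanSpace ℝ (Fin (k + 1)))) {t : ℝ}
    (ht : 0 ≤ t) :
    southLongestEdge X ≤ t ↔ ∀ x ∈ X, (∃ z ∈ X, z ≠ x ∧ z (Fin.last k) ≤ x (Fin.last k)) →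
      ∃ z ∈ X, z ≠ x ∧ z (Fin.last k) ≤ x (Fin.last k) ∧ ‖z - x‖ ≤ t := by
  unfold southLongestEdge
  split_ifs with h
  · simp only [Finset.sup'_le_iff, southDist_le_iff X _ ht]
  · rw [Finset.not_nonempty_iff_eq_empty] at h
    simp [h, ht]

theorem ongDist_nonneg {d : ℕ} (y : ℕ → EuclideanSpace ℝ (Fin d)) (i : ℕ) :
    0 ≤ ongDist y i := by
  unfold ongDist
  split_ifs with h
  · exact Finset.le_inf' _ _ fun z _ => norm_nonneg _
  · exact le_rfl

theorem ongDist_le_iff {d : ℕ} (y : ℕ → EuclideanSpace ℝ (Fin d)) (i : ℕ) {t : ℝ}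
    (ht : 0 ≤ t) : ongDist y i ≤ t ↔ (0 < i → ∃ j < i, ‖y i - y j‖ ≤ t) := by
  unfold ongDist
  split_ifs with h
  · have : 0 < i := by simpa [Nat.pos_iff_ne_zero] using h
    simp [Finset.inf'_le_iff, this]
  · have : i = 0 := by simpa using h
    simp [this, ht]

theorem ongLongestEdge_nonneg {d : ℕ} (y : ℕ → EuclideanSpace ℝ (Fin d)) (m : ℕ) :
    0 ≤ ongLongestEdge y m := by
  unfold ongLongestEdge
  split_ifs with h
  · obtain ⟨x, hx⟩ := h
    exact (ongDist_nonneg y x).trans (Finset.le_sup' _ hx)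
  · exact le_rfl

theorem ongLongestEdge_le_iff {d : ℕ} (y : ℕ → EuclideanSpace ℝ (Fin d)) (m : ℕ) {t : ℝ}
    (ht : 0 ≤ t) :
    ongLongestEdge y m ≤ t ↔ ∀ i < m, 0 < i → ∃ j < i, ‖y i - y j‖ ≤ t := by
  unfold ongLongestEdge
  split_ifs with h
  · simp only [Finset.sup'_le_iff, Finset.mem_range, ongDist_le_iff y _ ht]
  · have : m = 0 := by simpa using h
    simp [this, ht]

theorem ongLongestEdge_zero {d : ℕ} (y : ℕ → EuclideanSpace ℝ (Fin d)) :
    ongLongestEdge y 0 = 0 := by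
  simp [ongLongestEdge]

theorem ongLongestEdge_succ {d : ℕ} (y : ℕ → EuclideanSpace ℝ (Fin d)) (m : ℕ) :
    ongLongestEdge y (m + 1) = max (ongLongestEdge y m) (ongDist y m) := by
  rcases Nat.eq_zero_or_pos m with rfl | hm
  · have : (Finset.range 1).Nonempty := by simp
    rw [ongLongestEdge_zero, max_eq_right (ongDist_nonneg y 0)]
    simp [ongLongestEdge]
  · have h : (Finset.range m).Nonempty := by simpa using hm.ne'
    have h' : (Finset.range (m + 1)).Nonempty := by simp
    simp only [ongLongestEdge, h, h', dif_pos]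
    simp only [Finset.range_add_one]
    rw [Finset.sup'_insert, max_comm]

theorem ongLongestEdge_mono {d : ℕ} (y : ℕ → EuclideanSpace ℝ (Fin d)) :
    Monotone (ongLongestEdge y) :=
  monotone_nat_of_le_succ fun m => by rw [ongLongestEdge_succ]; exact le_max_left _ _

theorem measurable_ongDist {d : ℕ} (i : ℕ) :
    Measurable fun y : ℕ → EuclideanSpace ℝ (Fin d) => ongDist y i := by
  refine measurable_of_Iic fun t => ?_
  rcases lt_or_ge t 0 with ht | ht
  · convert MeasurableSet.empty
    ext y
    simpa using ht.trans_le (ongDist_nonneg y i)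
  · have : (fun y : ℕ → EuclideanSpace ℝ (Fin d) => ongDist y i) ⁻¹' Set.Iic t =
        {y | 0 < i → ∃ j < i, ‖y i - y j‖ ≤ t} := by
      ext y
      exact ongDist_le_iff y i ht
    rw [this]
    refine MeasurableSet.imp (.const _) ?_
    simp only [Set.ofPred_exists, ← exists_prop]
    refine MeasurableSet.iUnion fun j => MeasurableSet.iUnion fun _ => ?_
    exact measurableSet_le ((measurable_pi_apply i).sub (measurable_pi_apply j)).norm
      measurable_const

theorem measurable_ongLongestEdge {d : ℕ} (m : ℕ) :
    Measurable fun y : ℕ → EuclideanSpace ℝ (Fin d) => ongLongestEdge y m := by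
  induction m with
  | zero => simp only [ongLongestEdge_zero]; exact measurable_const
  | succ m ih => simp only [ongLongestEdge_succ]; exact ih.max (measurable_ongDist m)

/-- The factor d instead of √d is harmless: the bound is applied with c fixed or tending to 0. For d
= 0 nothing is known about the sign of c, hence the separate case. -/
theorem norm_le_of_forall_abs_le {d : ℕ} (v : EuclideanSpace ℝ (Fin d)) {c : ℝ}
    (h : ∀ i, |v i| ≤ c) : ‖v‖ ≤ d * c := by
  rcases Nat.eq_zero_or_pos d with rfl | hd
  · have : v = 0 := Subsingleton.elim _ _
    simp [this]
  have hc : 0 ≤ c := (abs_nonneg _).trans (h ⟨0, hd⟩)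
  have hd1 : (1 : ℝ) ≤ d := by exact_mod_cast hd
  rw [EuclideanSpace.norm_eq]
  apply Real.sqrt_le_iff.2 ⟨by positivity, ?_⟩
  calc ∑ i, ‖v i‖ ^ 2 ≤ ∑ _i : Fin d, c ^ 2 :=
        Finset.sum_le_sum fun i _ => by
          rw [Real.norm_eq_abs]; exact pow_le_pow_left₀ (abs_nonneg _) (h i) 2
    _ = d * c ^ 2 := by simp
    _ ≤ (d * c) ^ 2 := by
      rw [mul_pow]
      nlinarith [mul_nonneg (sub_nonneg.2 hd1) (sq_nonneg c)]

theorem ongLongestEdge_le_of_mem_openCube {d : ℕ} {y : ℕ → EuclideanSpace ℝ (Fin d)}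
    (hy : ∀ i, y i ∈ openCube d) (m : ℕ) : ongLongestEdge y m ≤ d := by
  rw [ongLongestEdge_le_iff y m (by positivity)]
  intro i _ hi
  refine ⟨0, hi, ?_⟩
  have := norm_le_of_forall_abs_le (y i - y 0) (c := 1) (fun l => by
    have h1 := hy i l
    have h2 := hy 0 l
    simp only [Set.mem_Ioo] at h1 h2
    rw [PiLp.sub_apply, abs_le]
    constructor <;> linarith)
  simpa using this

/-- Perturbing the points by at most `ε`, without changing the South order, changes the longest
edge by at most `2 * ε`. -/
theorem abs_southLongestEdge_image_sub_le {k : ℕ} [DecidableEq (EuclideanSpace ℝ (Fin (k + 1)))]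
    (X : Finset (EuclideanSpace ℝ (Fin (k + 1))))
    (φ : EuclideanSpace ℝ (Fin (k + 1)) → EuclideanSpace ℝ (Fin (k + 1)))
    {ε : ℝ} (h0 : 0 ≤ ε) (hε : ∀ x ∈ X, ‖φ x - x‖ ≤ ε) (hφ : Set.InjOn φ X)
    (hord : ∀ x ∈ X, ∀ z ∈ X,
      (φ z (Fin.last k) ≤ φ x (Fin.last k) ↔ z (Fin.last k) ≤ x (Fin.last k))) :
    |southLongestEdge (X.image φ) - southLongestEdge X| ≤ 2 * ε := by
  have key : ∀ x ∈ X, ∀ z ∈ X, |‖φ z - φ x‖ - ‖z - x‖| ≤ 2 * ε := by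
    intro x hx z hz
    refine (abs_norm_sub_norm_le _ _).trans ?_
    have : φ z - φ x - (z - x) = (φ z - z) - (φ x - x) := by abel
    rw [this]
    have := norm_sub_le (φ z - z) (φ x - x)
    linarith [hε x hx, hε z hz]
  rw [abs_sub_le_iff, sub_le_iff_le_add, sub_le_iff_le_add]
  constructor
  · rw [southLongestEdge_le_iff _ (by linarith [southLongestEdge_nonneg X])]
    intro x' hx' ⟨z', hz', hne, hle⟩
    obtain ⟨x, hx, rfl⟩ := Finset.mem_image.1 hx'
    obtain ⟨z, hz, rfl⟩ := Finset.mem_image.1 hz'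
    obtain ⟨w, hw, h1, h2, h3⟩ := (southLongestEdge_le_iff X (southLongestEdge_nonneg X)).1 le_rfl
      x hx ⟨z, hz, fun h => hne (by rw [h]), (hord x hx z hz).1 hle⟩
    refine ⟨φ w, Finset.mem_image_of_mem _ hw, fun h => h1 (hφ hw hx h), (hord x hx w hw).2 h2, ?_⟩
    have := (abs_le.1 (key x hx w hw)).2
    linarith
  · rw [southLongestEdge_le_iff _ (by linarith [southLongestEdge_nonneg (X.image φ)])]
    intro x hx ⟨z, hz, hne, hle⟩
    obtain ⟨w', hw', h1, h2, h3⟩ := (southLongestEdge_le_iff (X.image φ)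
      (southLongestEdge_nonneg _)).1 le_rfl (φ x) (Finset.mem_image_of_mem _ hx)
      ⟨φ z, Finset.mem_image_of_mem _ hz, fun h => hne (hφ hz hx h), (hord x hx z hz).2 hle⟩
    obtain ⟨w, hw, rfl⟩ := Finset.mem_image.1 hw'
    refine ⟨w, hw, fun h => h1 (by rw [h]), (hord x hx w hw).1 h2, ?_⟩
    have := (abs_le.1 (key x hx w hw)).1
    linarith

/-- The longest edge of the South tree on points listed by increasing height dominates that of the
on-line nearest-neighbour graph on their projections. -/
theorem ongLongestEdge_le_southLongestEdge {k n : ℕ}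
    [DecidableEq (EuclideanSpace ℝ (Fin (k + 1)))]
    (Z : ℕ → EuclideanSpace ℝ (Fin (k + 1))) (y : ℕ → EuclideanSpace ℝ (Fin k))
    (hy : ∀ i j, ‖y i - y j‖ ≤ ‖Z i - Z j‖)
    (hZ : StrictMonoOn (fun i => Z i (Fin.last k)) (Set.Iio n)) :
    ongLongestEdge y n ≤ southLongestEdge ((Finset.range n).image Z) := by
  rw [ongLongestEdge_le_iff _ _ (southLongestEdge_nonneg _)]
  intro i hi hi0
  have hmem : ∀ j < n, Z j ∈ (Finset.range n).image Z := fun j hj =>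
    Finset.mem_image_of_mem _ (Finset.mem_range.2 hj)
  have h0 : Z 0 (Fin.last k) < Z i (Fin.last k) := hZ (hi0.trans hi) hi hi0
  -- `Z 0` shows that `Z i` is not the sink. Its South neighbour is lower, hence has a smaller
  -- index, and projecting does not increase the distance.
  obtain ⟨w, hw, h1, h2, h3⟩ := (southLongestEdge_le_iff _ (southLongestEdge_nonneg _)).1 le_rfl
    (Z i) (hmem i hi) ⟨Z 0, hmem 0 (hi0.trans hi), fun h => by rw [h] at h0; exact lt_irrefl _ h0,
      h0.le⟩
  obtain ⟨j, hj, rfl⟩ := Finset.mem_image.1 hw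
  have hjn : j < n := Finset.mem_range.1 hj
  refine ⟨j, ?_, (hy i j).trans (by rwa [norm_sub_rev])⟩
  rcases lt_trichotomy j i with h | h | h
  · exact h
  · exact absurd (by rw [h]) h1
  · exact absurd (hZ hi hjn h) (not_lt.2 h2)

/-- If every point that is higher than `δ` has a point strictly below it within distance `c`, then
the longest edge of the South tree exceeds that of the on-line nearest-neighbour graph on the
projections by at most `c`. -/
theorem southLongestEdge_le_ongLongestEdge_add {k n : ℕ}
    [DecidableEq (EuclideanSpace ℝ (Fin (k + 1)))]
    (Z : ℕ → EuclideanSpace ℝ (Fin (k + 1))) (y : ℕ → EuclideanSpace ℝ (Fin k))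
    (hy : ∀ i j, ‖Z i - Z j‖ ≤ ‖y i - y j‖ + |Z i (Fin.last k) - Z j (Fin.last k)|)
    (hZ : StrictMonoOn (fun i => Z i (Fin.last k)) (Set.Iio n)) {δ c : ℝ} (hδ : δ ≤ c)
    (hpos : ∀ i < n, 0 ≤ Z i (Fin.last k)) (hc : 0 ≤ c)
    (hdense : ∀ i < n, δ ≤ Z i (Fin.last k) →
      ∃ j < n, Z j (Fin.last k) < Z i (Fin.last k) ∧ ‖Z j - Z i‖ ≤ c) :
    southLongestEdge ((Finset.range n).image Z) ≤ ongLongestEdge y n + c := by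
  have hnn := ongLongestEdge_nonneg y n
  rw [southLongestEdge_le_iff _ (by linarith)]
  intro x hx ⟨z, hz, hne, hle⟩
  obtain ⟨i, hi, rfl⟩ := Finset.mem_image.1 hx
  obtain ⟨j, hj, rfl⟩ := Finset.mem_image.1 hz
  simp only [Finset.mem_range] at hi hj
  have hmem : ∀ j < n, Z j ∈ (Finset.range n).image Z := fun j hj =>
    Finset.mem_image_of_mem _ (Finset.mem_range.2 hj)
  have hne' : ∀ l, Z l (Fin.last k) < Z i (Fin.last k) → Z l ≠ Z i := fun l hl h => by
    rw [h] at hl; exact lt_irrefl _ hl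
  -- A high point is handled by density. For a low point the on-line neighbour is also lower, and
  -- both heights lie in [0, δ), so the vertical term costs less than δ ≤ c.
  rcases le_or_gt δ (Z i (Fin.last k)) with h | h
  · obtain ⟨l, hl, h1, h2⟩ := hdense i hi h
    exact ⟨Z l, hmem l hl, hne' l h1, h1.le, by linarith⟩
  · have hji : j < i := by
      rcases lt_trichotomy j i with h' | h' | h'
      · exact h'
      · exact absurd (by rw [h']) hne
      · exact absurd (hZ hi hj h') (not_lt.2 hle)
    obtain ⟨l, hl, hl'⟩ := (ongLongestEdge_le_iff y n hnn).1 le_rfl i hi (by omega)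
    have h1 : Z l (Fin.last k) < Z i (Fin.last k) := hZ (hl.trans hi) hi hl
    refine ⟨Z l, hmem l (hl.trans hi), hne' l h1, h1.le, ?_⟩
    rw [norm_sub_rev]
    refine (hy i l).trans (add_le_add hl' ?_)
    have := hpos l (hl.trans hi)
    rw [abs_of_pos (by linarith)]
    linarith

end Deterministic


/-! ### Random finite sets and Möbius inversion -/

section RandomFinset

variable {Ω Ω' β : Type*}

/-- Since only the finitely many subsets of Λ occur, measurability and integration reduce to the
events `occ ω = A`. -/
theorem comp_eq_sum_indicator {occ : Ω → Finset β} {Λ : Finset β} (hΛ : ∀ ω, occ ω ⊆ Λ)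
    (g : Finset β → ℝ) :
    (fun ω => g (occ ω)) =
      fun ω => ∑ A ∈ Λ.powerset, {ω | occ ω = A}.indicator (fun _ => g A) ω := by
  ext ω
  rw [Finset.sum_eq_single (occ ω)]
  · simp
  · intro B _ hB
    rw [Set.indicator_of_notMem]
    exact fun h => hB h.symm
  · intro h
    exact absurd (Finset.mem_powerset.2 (hΛ ω)) h

variable [DecidableEq β]

theorem setOf_subset_eq_union (occ : Ω → Finset β) (A : Finset β) :
    {ω | occ ω ⊆ A} = {ω | occ ω = A} ∪ ⋃ B ∈ A.ssubsets, {ω | occ ω = B} := by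
  ext ω
  simp only [Set.mem_ofPred_eq, Set.mem_union, Set.mem_iUnion, Finset.mem_ssubsets, exists_prop,
    exists_eq_right']
  exact ⟨fun h => h.eq_or_ssubset, fun h => h.elim (fun h => h.subset) fun h => h.subset⟩

variable [MeasurableSpace Ω] [MeasurableSpace Ω'] {μ : Measure Ω} {μ' : Measure Ω'}

/-- Strong induction on A: remove from the event of containment in A the events of equality with a
proper subset. -/
theorem measurableSet_eq_of_subset {occ : Ω → Finset β}
    (hm : ∀ A, MeasurableSet {ω | occ ω ⊆ A}) (A : Finset β) :
    MeasurableSet {ω | occ ω = A} := by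
  induction A using Finset.strongInduction with
  | H A ih =>
    have h : {ω | occ ω = A} = {ω | occ ω ⊆ A} \ ⋃ B ∈ A.ssubsets, {ω | occ ω = B} := by
      rw [setOf_subset_eq_union, Set.union_sdiff_right, eq_comm, sdiff_eq_left]
      rw [Set.disjoint_iff]
      rintro ω ⟨h1, h2⟩
      simp only [Set.mem_ofPred_eq, Set.mem_iUnion, Finset.mem_ssubsets, exists_prop,
        exists_eq_right'] at h1 h2
      exact h2.ne h1
    rw [h]
    exact (hm A).diff (Finset.measurableSet_biUnion _ fun B hB => ih B (Finset.mem_ssubsets.1 hB))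

theorem measure_subset_eq_add_sum {occ : Ω → Finset β}
    (hm : ∀ A, MeasurableSet {ω | occ ω ⊆ A}) (A : Finset β) :
    μ {ω | occ ω ⊆ A} = μ {ω | occ ω = A} + ∑ B ∈ A.ssubsets, μ {ω | occ ω = B} := by
  have hm' := measurableSet_eq_of_subset hm
  rw [setOf_subset_eq_union, measure_union, measure_biUnion_finset _ fun B _ => hm' B]
  · intro B _ C _ hBC
    rw [Function.onFun, Set.disjoint_iff]
    rintro ω ⟨h1, h2⟩
    exact hBC (h1.symm.trans h2)
  · rw [Set.disjoint_iff]
    rintro ω ⟨h1, h2⟩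
    simp only [Set.mem_ofPred_eq, Set.mem_iUnion, Finset.mem_ssubsets, exists_prop,
      exists_eq_right'] at h1 h2
    exact h2.ne h1
  · exact Finset.measurableSet_biUnion _ fun B _ => hm' B

/-- The law of a random finite set is determined by the probabilities of being contained in given
finite sets. -/
theorem measure_eq_of_measure_subset_eq [IsFiniteMeasure μ]
    {occ : Ω → Finset β} {occ' : Ω' → Finset β}
    (hm : ∀ A, MeasurableSet {ω | occ ω ⊆ A}) (hm' : ∀ A, MeasurableSet {ω | occ' ω ⊆ A})
    (h : ∀ A, μ {ω | occ ω ⊆ A} = μ' {ω | occ' ω ⊆ A}) (A : Finset β) :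
    μ {ω | occ ω = A} = μ' {ω | occ' ω = A} := by
  induction A using Finset.strongInduction with
  | H A ih =>
    have h1 := h A
    rw [measure_subset_eq_add_sum hm, measure_subset_eq_add_sum hm'] at h1
    have h2 : ∑ B ∈ A.ssubsets, μ {ω | occ ω = B} = ∑ B ∈ A.ssubsets, μ' {ω | occ' ω = B} :=
      Finset.sum_congr rfl fun B hB => ih B (Finset.mem_ssubsets.1 hB)
    rw [← h2] at h1
    exact (ENNReal.add_left_inj (by simp [ENNReal.sum_eq_top])).1 h1

theorem measurable_comp_of_measurableSet_subset {occ : Ω → Finset β} {Λ : Finset β}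
    (hΛ : ∀ ω, occ ω ⊆ Λ) (hm : ∀ A, MeasurableSet {ω | occ ω ⊆ A}) (g : Finset β → ℝ) :
    Measurable fun ω => g (occ ω) := by
  rw [comp_eq_sum_indicator hΛ g]
  exact Finset.measurable_fun_sum _ fun A _ =>
    measurable_const.indicator (measurableSet_eq_of_subset hm A)

theorem integral_comp_eq_of_measure_subset_eq [IsFiniteMeasure μ] [IsFiniteMeasure μ']
    {occ : Ω → Finset β} {occ' : Ω' → Finset β} {Λ : Finset β}
    (hΛ : ∀ ω, occ ω ⊆ Λ) (hΛ' : ∀ ω, occ' ω ⊆ Λ)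
    (hm : ∀ A, MeasurableSet {ω | occ ω ⊆ A}) (hm' : ∀ A, MeasurableSet {ω | occ' ω ⊆ A})
    (h : ∀ A, μ {ω | occ ω ⊆ A} = μ' {ω | occ' ω ⊆ A}) (g : Finset β → ℝ) :
    ∫ ω, g (occ ω) ∂μ = ∫ ω, g (occ' ω) ∂μ' := by
  rw [comp_eq_sum_indicator hΛ g, comp_eq_sum_indicator hΛ' g,
    integral_finsetSum, integral_finsetSum]
  · refine Finset.sum_congr rfl fun A _ => ?_
    rw [integral_indicator_const _ (measurableSet_eq_of_subset hm A),
      integral_indicator_const _ (measurableSet_eq_of_subset hm' A), measureReal_def,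
      measureReal_def, measure_eq_of_measure_subset_eq hm hm' h A]
  · exact fun A _ => (integrable_const _).indicator (measurableSet_eq_of_subset hm' A)
  · exact fun A _ => (integrable_const _).indicator (measurableSet_eq_of_subset hm A)

end RandomFinset

/-! ### Rounding points to a grid -/

section Grid

/-- The point of the grid of mesh `1 / (M + 1)` obtained by rounding every coordinate down. -/
noncomputable def roundDown {d : ℕ} (M : ℕ) (x : EuclideanSpace ℝ (Fin d)) :
    EuclideanSpace ℝ (Fin d) :=
  WithLp.toLp 2 fun i => (⌊((M : ℝ) + 1) * x i⌋ : ℝ) / (M + 1)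

theorem roundDown_apply {d : ℕ} (M : ℕ) (x : EuclideanSpace ℝ (Fin d)) (i : Fin d) :
    roundDown M x i = (⌊((M : ℝ) + 1) * x i⌋ : ℝ) / (M + 1) := rfl

theorem measurable_roundDown {d : ℕ} (M : ℕ) :
    Measurable (roundDown M : EuclideanSpace ℝ (Fin d) → EuclideanSpace ℝ (Fin d)) := by
  refine (WithLp.measurable_toLp 2 _).comp (measurable_pi_lambda _ fun i => ?_)
  have : Measurable fun x : EuclideanSpace ℝ (Fin d) => ((M : ℝ) + 1) * x i := by fun_prop
  have h2 : Measurable fun n : ℤ => (n : ℝ) := measurable_from_top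
  exact (h2.comp (Int.measurable_floor.comp this)).div_const _

theorem finite_roundDown_image_openCube (d M : ℕ) :
    (roundDown M '' openCube d).Finite := by
  have hfin : (Set.univ.pi fun _ : Fin d => Set.Icc (0 : ℤ) (M + 1)).Finite :=
    Set.Finite.pi fun _ => Set.finite_Icc _ _
  refine (hfin.image fun c => (WithLp.toLp 2 fun i => (c i : ℝ) / (M + 1) :
    EuclideanSpace ℝ (Fin d))).subset ?_
  rintro _ ⟨x, hx, rfl⟩
  refine ⟨fun i => ⌊((M : ℝ) + 1) * x i⌋, ?_, rfl⟩
  intro i _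
  have h := hx i
  have hM : (0 : ℝ) < (M : ℝ) + 1 := by positivity
  refine ⟨Int.floor_nonneg.2 (mul_nonneg hM.le h.1.le), ?_⟩
  have h2 : ((M : ℝ) + 1) * x i ≤ ((M + 1 : ℤ) : ℝ) := by
    push_cast
    nlinarith [h.2]
  exact_mod_cast (Int.floor_le _).trans h2

theorem abs_floor_mul_div_sub_le (M : ℕ) (a : ℝ) :
    |(⌊((M : ℝ) + 1) * a⌋ : ℝ) / (M + 1) - a| ≤ 1 / (M + 1) := by
  have hM : (0 : ℝ) < (M : ℝ) + 1 := by positivity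
  have h1 := Int.floor_le (((M : ℝ) + 1) * a)
  have h2 := Int.lt_floor_add_one (((M : ℝ) + 1) * a)
  have : (⌊((M : ℝ) + 1) * a⌋ : ℝ) / (M + 1) - a =
      (⌊((M : ℝ) + 1) * a⌋ - ((M : ℝ) + 1) * a) / (M + 1) := by
    field_simp
  rw [this, abs_div, abs_of_pos hM]
  refine div_le_div_of_nonneg_right ?_ hM.le
  rw [abs_le]
  constructor <;> linarith

theorem norm_roundDown_sub_le {d : ℕ} (M : ℕ) (x : EuclideanSpace ℝ (Fin d)) :
    ‖roundDown M x - x‖ ≤ d * (1 / ((M : ℝ) + 1)) :=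
  norm_le_of_forall_abs_le _ fun i => abs_floor_mul_div_sub_le M (x i)

theorem tendsto_roundDown {d : ℕ} (x : EuclideanSpace ℝ (Fin d)) :
    Tendsto (fun M => roundDown M x) atTop (𝓝 x) := by
  rw [tendsto_iff_norm_sub_tendsto_zero]
  refine squeeze_zero (fun _ => norm_nonneg _) (fun M => norm_roundDown_sub_le M x) ?_
  simpa using (tendsto_one_div_add_atTop_nhds_zero_nat (𝕜 := ℝ)).const_mul (d : ℝ)

/-- Rounding down is monotone, so weak inequalities survive at every mesh; strict ones survive once
the mesh is fine enough. -/
theorem eventually_roundDown_le_iff {d : ℕ} (x z : EuclideanSpace ℝ (Fin d)) (i : Fin d) :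
    ∀ᶠ M in atTop, (roundDown M z i ≤ roundDown M x i ↔ z i ≤ x i) := by
  rcases le_or_gt (z i) (x i) with h | h
  · refine Eventually.of_forall fun M => iff_of_true ?_ h
    rw [roundDown_apply, roundDown_apply]
    gcongr
  · have hx := ((EuclideanSpace.proj (𝕜 := ℝ) i).continuous.tendsto x).comp (tendsto_roundDown x)
    have hz := ((EuclideanSpace.proj (𝕜 := ℝ) i).continuous.tendsto z).comp (tendsto_roundDown z)
    filter_upwards [hx.eventually_lt hz h] with M hM
    exact iff_of_false (not_le.2 hM) (not_le.2 h)

/-- For a fixed finite set, fine rounding is injective and keeps the height order, so the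
perturbation bound applies with a displacement tending to 0. -/
theorem tendsto_southLongestEdge_image_roundDown {k : ℕ}
    [DecidableEq (EuclideanSpace ℝ (Fin (k + 1)))]
    (X : Finset (EuclideanSpace ℝ (Fin (k + 1)))) :
    Tendsto (fun M => southLongestEdge (X.image (roundDown M))) atTop
      (𝓝 (southLongestEdge X)) := by
  have h1 : ∀ᶠ M in atTop, ∀ x ∈ X, ∀ z ∈ X, (roundDown M z (Fin.last k) ≤
      roundDown M x (Fin.last k) ↔ z (Fin.last k) ≤ x (Fin.last k)) := by
    simp only [Filter.eventually_all_finset]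
    exact fun x _ z _ => eventually_roundDown_le_iff x z _
  have h2 : ∀ᶠ M in atTop, ∀ x ∈ X, ∀ z ∈ X, roundDown M x = roundDown M z → x = z := by
    simp only [Filter.eventually_all_finset]
    intro x _ z _
    by_cases hxz : x = z
    · exact Eventually.of_forall fun _ _ => hxz
    · filter_upwards [((tendsto_roundDown x).prodMk_nhds (tendsto_roundDown z)).eventually
        (isOpen_ne_fun continuous_fst continuous_snd |>.mem_nhds hxz)] with M hM h
      exact absurd h hM
  rw [tendsto_iff_norm_sub_tendsto_zero]
  refine squeeze_zero' (Eventually.of_forall fun _ => norm_nonneg _) (g := fun M : ℕ =>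
    2 * (((k + 1 : ℕ) : ℝ) * (1 / ((M : ℝ) + 1)))) ?_ ?_
  · filter_upwards [h1, h2] with M hM1 hM2
    exact abs_southLongestEdge_image_sub_le X _ (by positivity)
      (fun x _ => norm_roundDown_sub_le M x)
      (fun x hx z hz h => hM2 x hx z hz h) hM1
  · simpa using ((tendsto_one_div_add_atTop_nhds_zero_nat (𝕜 := ℝ)).const_mul
      ((k + 1 : ℕ) : ℝ)).const_mul 2

end Grid

/-! ### Avoidance probabilities determine the law of the longest edge -/

section Renyi

/-- The bridge to avoidance events: the rounded set lies in A exactly when the original set avoids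
the points that round outside A. -/
theorem setOf_image_subset {d : ℕ} [DecidableEq (EuclideanSpace ℝ (Fin d))]
    {Ω : Type*} (P : Ω → Finset (EuclideanSpace ℝ (Fin d))) (M : ℕ)
    (A : Finset (EuclideanSpace ℝ (Fin d))) :
    {ω | (P ω).image (roundDown M) ⊆ A} =
      {ω | ∀ x ∈ P ω, x ∉ (roundDown M ⁻¹' (A : Set (EuclideanSpace ℝ (Fin d))))ᶜ} := by
  ext ω
  simp [Finset.image_subset_iff]

variable {k : ℕ} {Ω Ω' : Type*} [MeasurableSpace Ω] [MeasurableSpace Ω'] {μ : Measure Ω}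
  {μ' : Measure Ω'} {P : Ω → Finset (EuclideanSpace ℝ (Fin (k + 1)))}
  {P' : Ω' → Finset (EuclideanSpace ℝ (Fin (k + 1)))}

theorem measurableSet_compl_preimage_roundDown {d : ℕ} (M : ℕ)
    (A : Finset (EuclideanSpace ℝ (Fin d))) :
    MeasurableSet (roundDown M ⁻¹' (A : Set (EuclideanSpace ℝ (Fin d))))ᶜ :=
  (measurable_roundDown M A.measurableSet).compl

theorem image_roundDown_subset {d : ℕ} [DecidableEq (EuclideanSpace ℝ (Fin d))]
    {X : Finset (EuclideanSpace ℝ (Fin d))} (hX : (X : Set (EuclideanSpace ℝ (Fin d))) ⊆ openCube d)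
    (M : ℕ) : X.image (roundDown M) ⊆ (finite_roundDown_image_openCube d M).toFinset := by
  intro y hy
  obtain ⟨x, hx, rfl⟩ := Finset.mem_image.1 hy
  simp only [Set.Finite.mem_toFinset]
  exact Set.mem_image_of_mem _ (hX hx)

/-- A pointwise limit of functions of the rounded set, which takes finitely many values. -/
theorem measurable_southLongestEdge
    (hP : ∀ ω, (P ω : Set (EuclideanSpace ℝ (Fin (k + 1)))) ⊆ openCube (k + 1))
    (hm : ∀ B, MeasurableSet B → MeasurableSet {ω | ∀ x ∈ P ω, x ∉ B}) :
    Measurable fun ω => southLongestEdge (P ω) := by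
  classical
  refine measurable_of_tendsto_metrizable
    (f := fun M ω => southLongestEdge ((P ω).image (roundDown M))) (fun M => ?_)
    (tendsto_pi_nhds.2 fun ω => tendsto_southLongestEdge_image_roundDown (P ω))
  exact measurable_comp_of_measurableSet_subset (occ := fun ω => (P ω).image (roundDown M))
    (fun ω => image_roundDown_subset (hP ω) M)
    (fun A => by
      rw [setOf_image_subset]
      exact hm _ (measurableSet_compl_preimage_roundDown M A)) southLongestEdge

theorem tendsto_integral_southLongestEdge_roundDown [IsProbabilityMeasure μ]
    [DecidableEq (EuclideanSpace ℝ (Fin (k + 1)))] (f : BoundedContinuousFunction ℝ ℝ)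
    (hP : ∀ ω, (P ω : Set (EuclideanSpace ℝ (Fin (k + 1)))) ⊆ openCube (k + 1))
    (hm : ∀ B, MeasurableSet B → MeasurableSet {ω | ∀ x ∈ P ω, x ∉ B}) :
    Tendsto (fun M => ∫ ω, f (southLongestEdge ((P ω).image (roundDown M))) ∂μ) atTop
      (𝓝 (∫ ω, f (southLongestEdge (P ω)) ∂μ)) := by
  refine tendsto_integral_of_dominated_convergence (fun _ => ‖f‖) (fun M => ?_)
    (integrable_const _) (fun M => Eventually.of_forall fun ω => f.norm_coe_le_norm _)
    (Eventually.of_forall fun ω => (f.continuous.tendsto _).comp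
      (tendsto_southLongestEdge_image_roundDown (P ω)))
  exact (measurable_comp_of_measurableSet_subset (occ := fun ω => (P ω).image (roundDown M))
    (fun ω => image_roundDown_subset (hP ω) M)
    (fun A => by
      rw [setOf_image_subset]
      exact hm _ (measurableSet_compl_preimage_roundDown M A))
    (fun A => f (southLongestEdge A))).aestronglyMeasurable

/-- Two random finite subsets of the cube with the same avoidance probabilities have longest South
edges with the same law. -/
theorem map_southLongestEdge_eq [IsProbabilityMeasure μ] [IsProbabilityMeasure μ']
    (hP : ∀ ω, (P ω : Set (EuclideanSpace ℝ (Fin (k + 1)))) ⊆ openCube (k + 1))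
    (hP' : ∀ ω, (P' ω : Set (EuclideanSpace ℝ (Fin (k + 1)))) ⊆ openCube (k + 1))
    (hm : ∀ B, MeasurableSet B → MeasurableSet {ω | ∀ x ∈ P ω, x ∉ B})
    (hm' : ∀ B, MeasurableSet B → MeasurableSet {ω | ∀ x ∈ P' ω, x ∉ B})
    (h : ∀ B, MeasurableSet B → μ {ω | ∀ x ∈ P ω, x ∉ B} = μ' {ω | ∀ x ∈ P' ω, x ∉ B}) :
    μ.map (fun ω => southLongestEdge (P ω)) = μ'.map (fun ω => southLongestEdge (P' ω)) := by
  classical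
  have hmL := measurable_southLongestEdge hP hm
  have hmL' := measurable_southLongestEdge hP' hm'
  have := Measure.isProbabilityMeasure_map (μ := μ) hmL.aemeasurable
  have := Measure.isProbabilityMeasure_map (μ := μ') hmL'.aemeasurable
  refine ext_of_forall_integral_eq_of_IsFiniteMeasure fun f => ?_
  rw [integral_map hmL.aemeasurable f.continuous.aestronglyMeasurable,
    integral_map hmL'.aemeasurable f.continuous.aestronglyMeasurable]
  have l2 := tendsto_integral_southLongestEdge_roundDown (μ := μ') f hP' hm'
  -- At each mesh the two rounded sets have the same containment probabilities, hence the same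
  -- expectations; then the mesh tends to 0.
  refine tendsto_nhds_unique 
    (tendsto_integral_southLongestEdge_roundDown f hP hm) (l2.congr fun M => ?_)
  refine (integral_comp_eq_of_measure_subset_eq (fun ω => image_roundDown_subset (hP ω) M)
    (fun ω => image_roundDown_subset (hP' ω) M) (fun A => ?_) (fun A => ?_) (fun A => ?_)
    fun A => f (southLongestEdge A)).symm
  · rw [setOf_image_subset]
    exact hm _ (measurableSet_compl_preimage_roundDown M A)
  · rw [setOf_image_subset]
    exact hm' _ (measurableSet_compl_preimage_roundDown M A)
  · rw [setOf_image_subset, setOf_image_subset]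
    exact h _ (measurableSet_compl_preimage_roundDown M A)

end Renyi


/-! ### Uniform points of the cube, split into projection and height -/

section Uniform

instance isProbabilityMeasure_uniform01 : IsProbabilityMeasure uniform01 :=
  ⟨by simp [uniform01]⟩

theorem openCube_eq_preimage (d : ℕ) :
    openCube d = (WithLp.ofLp : EuclideanSpace ℝ (Fin d) → Fin d → ℝ) ⁻¹'
      (Set.univ.pi fun _ => Set.Ioo (0 : ℝ) 1) := by
  ext x
  simp [openCube]

theorem isOpen_openCube (d : ℕ) : IsOpen (openCube d) := by
  rw [openCube_eq_preimage]
  exact (isOpen_set_pi Set.finite_univ fun _ _ => isOpen_Ioo).preimage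
    (PiLp.continuous_ofLp 2 _)

theorem measurableSet_openCube (d : ℕ) : MeasurableSet (openCube d) :=
  (isOpen_openCube d).measurableSet

instance isProbabilityMeasure_uniformCube (d : ℕ) : IsProbabilityMeasure (uniformCube d) := by
  constructor
  rw [uniformCube, Measure.restrict_apply_univ, openCube_eq_preimage,
    (PiLp.volume_preserving_ofLp (Fin d)).measure_preimage
      (MeasurableSet.univ_pi fun _ => measurableSet_Ioo).nullMeasurableSet, volume_pi_pi]
  simp

theorem ae_mem_openCube (d : ℕ) : ∀ᵐ x ∂uniformCube d, x ∈ openCube d :=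
  ae_restrict_mem (measurableSet_openCube d)

/-- Append a last coordinate. -/
noncomputable def appendLast {k : ℕ} (p : EuclideanSpace ℝ (Fin k) × ℝ) :
    EuclideanSpace ℝ (Fin (k + 1)) :=
  WithLp.toLp 2 (Fin.snoc (α := fun _ => ℝ) (WithLp.ofLp p.1) p.2)

@[simp]
theorem appendLast_last {k : ℕ} (p : EuclideanSpace ℝ (Fin k) × ℝ) :
    appendLast p (Fin.last k) = p.2 := by
  simp [appendLast]

@[simp]
theorem appendLast_castSucc {k : ℕ} (p : EuclideanSpace ℝ (Fin k) × ℝ) (i : Fin k) :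
    appendLast p i.castSucc = p.1 i := by
  simp [appendLast]

theorem appendLast_mem_openCube_iff {k : ℕ} (p : EuclideanSpace ℝ (Fin k) × ℝ) :
    appendLast p ∈ openCube (k + 1) ↔ p.1 ∈ openCube k ∧ p.2 ∈ Set.Ioo (0 : ℝ) 1 := by
  simp only [openCube, Set.mem_ofPred_eq, Fin.forall_fin_succ', appendLast_last,
    appendLast_castSucc]

theorem measurePreserving_appendLast_volume (k : ℕ) :
    MeasurePreserving (appendLast (k := k)) ((volume : Measure (EuclideanSpace ℝ (Fin k))).prod
      (volume : Measure ℝ)) volume := by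
  have h1 := (volume_preserving_piFinSuccAbove (fun _ : Fin (k + 1) => ℝ) (Fin.last k)).symm
  have h2 : MeasurePreserving (Prod.swap : EuclideanSpace ℝ (Fin k) × ℝ → ℝ × _)
    (volume.prod volume) (volume.prod volume) := Measure.measurePreserving_swap
  have h3 : MeasurePreserving (Prod.map id WithLp.ofLp : ℝ × EuclideanSpace ℝ (Fin k) → _)
    (volume.prod volume) (volume.prod volume) :=
    (MeasurePreserving.id _).prod (PiLp.volume_preserving_ofLp (Fin k))
  have h4 := ((PiLp.volume_preserving_toLp (Fin (k + 1))).comp h1).comp (h3.comp h2)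
  have h5 : appendLast (k := k) = (WithLp.toLp 2 ∘
      (MeasurableEquiv.piFinSuccAbove (fun _ : Fin (k + 1) => ℝ) (Fin.last k)).symm) ∘
      Prod.map id WithLp.ofLp ∘ Prod.swap := by
    funext p
    simp [appendLast, MeasurableEquiv.piFinSuccAbove, Fin.insertNthEquiv]
  rw [h5]
  exact h4

/-- This splitting allows the heights to be frozen while the projections stay uniform. -/
theorem measurePreserving_appendLast (k : ℕ) :
    MeasurePreserving (appendLast (k := k)) ((uniformCube k).prod uniform01)
      (uniformCube (k + 1)) := by
  have := (measurePreserving_appendLast_volume k).restrict_preimage (measurableSet_openCube (k + 1))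
  have h : appendLast ⁻¹' openCube (k + 1) = openCube k ×ˢ Set.Ioo (0 : ℝ) 1 := by
    ext p
    exact appendLast_mem_openCube_iff p
  rw [h] at this
  rw [uniformCube, uniform01, Measure.prod_restrict, uniformCube]
  exact this

theorem norm_appendLast_sub_sq {k : ℕ} (p q : EuclideanSpace ℝ (Fin k) × ℝ) :
    ‖appendLast p - appendLast q‖ ^ 2 = ‖p.1 - q.1‖ ^ 2 + |p.2 - q.2| ^ 2 := by
  rw [EuclideanSpace.norm_sq_eq, EuclideanSpace.norm_sq_eq, Fin.sum_univ_castSucc]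
  simp

theorem norm_fst_sub_le_norm_appendLast_sub {k : ℕ} (p q : EuclideanSpace ℝ (Fin k) × ℝ) :
    ‖p.1 - q.1‖ ≤ ‖appendLast p - appendLast q‖ := by
  rw [← abs_norm, ← abs_norm (appendLast p - appendLast q), ← sq_le_sq, norm_appendLast_sub_sq]
  nlinarith [sq_nonneg |p.2 - q.2|]

theorem norm_appendLast_sub_le {k : ℕ} (p q : EuclideanSpace ℝ (Fin k) × ℝ) :
    ‖appendLast p - appendLast q‖ ≤ ‖p.1 - q.1‖ + |p.2 - q.2| := by
  refine abs_le_of_sq_le_sq' ?_ (by positivity) |>.2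
  rw [norm_appendLast_sub_sq]
  nlinarith [mul_nonneg (norm_nonneg (p.1 - q.1)) (abs_nonneg (p.2 - q.2))]

end Uniform

/-! ### I.i.d. sequences -/

section InfiniteProduct

variable {α : Type*} [MeasurableSpace α] (ν : Measure α) [IsProbabilityMeasure ν]

theorem ae_forall_infinitePi {s : Set α} (hs : ∀ᵐ x ∂ν, x ∈ s) :
    ∀ᵐ y ∂Measure.infinitePi (fun _ : ℕ => ν), ∀ i, y i ∈ s := by
  rw [ae_all_iff]
  intro i
  exact (measurePreserving_eval_infinitePi (fun _ : ℕ => ν) i).quasiMeasurePreserving.ae hs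

theorem infinitePi_forall_lt {s : ℕ → Set α} (hs : ∀ i, MeasurableSet (s i)) (n : ℕ) :
    Measure.infinitePi (fun _ : ℕ => ν) {y | ∀ i < n, y i ∈ s i} =
      ∏ i ∈ Finset.range n, ν (s i) := by
  rw [← Measure.infinitePi_pi (fun _ : ℕ => ν) (s := Finset.range n) (t := s) fun i _ => hs i]
  congr 1
  ext y
  simp

/-- The first n terms all miss s with probability ν(sᶜ)^n, which tends to 0. -/
theorem ae_exists_mem_infinitePi {s : Set α} (hs : MeasurableSet s) (h0 : ν s ≠ 0) :
    ∀ᵐ y ∂Measure.infinitePi (fun _ : ℕ => ν), ∃ i, y i ∈ s := by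
  have hlt : ν sᶜ < 1 := by
    rw [prob_compl_eq_one_sub hs]
    exact ENNReal.sub_lt_self ENNReal.one_ne_top one_ne_zero h0
  have hlim := ENNReal.tendsto_pow_atTop_nhds_zero_of_lt_one hlt
  rw [ae_iff]
  refine le_antisymm (ge_of_tendsto' hlim fun n => ?_) zero_le
  have := infinitePi_forall_lt ν (s := fun _ => sᶜ) (fun _ => hs.compl) n
  rw [Finset.prod_const, Finset.card_range] at this
  rw [← this]
  refine measure_mono fun y hy i _ => ?_
  simp only [not_exists, Set.mem_ofPred_eq] at hy
  exact hy i

/-- Resampling one coordinate preserves an infinite product measure. -/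
theorem measurePreserving_update_infinitePi (n : ℕ) :
    MeasurePreserving (fun p : (ℕ → α) × α => Function.update p.1 n p.2)
      ((Measure.infinitePi fun _ : ℕ => ν).prod ν) (Measure.infinitePi fun _ : ℕ => ν) := by
  have hm : Measurable fun p : (ℕ → α) × α => Function.update p.1 n p.2 := by
    refine measurable_pi_lambda _ fun i => ?_
    by_cases h : i = n
    · subst h; simpa using measurable_snd
    · simp only [Function.update_of_ne h]; exact (measurable_pi_apply i).comp measurable_fst
  refine ⟨hm, Measure.eq_infinitePi _ fun s t ht => ?_⟩
  rw [Measure.map_apply hm (MeasurableSet.pi s.countable_toSet fun i _ => ht i)]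
  have : (fun p : (ℕ → α) × α => Function.update p.1 n p.2) ⁻¹' (Set.pi s t) =
      (Set.pi (s.erase n : Finset ℕ) t) ×ˢ (if n ∈ s then t n else Set.univ) := by
    ext p
    simp only [Set.mem_preimage, Set.mem_pi, Finset.mem_coe, Set.mem_prod, Finset.mem_erase]
    constructor
    · intro h
      refine ⟨fun i hi => by simpa [Function.update_of_ne hi.1] using h i hi.2, ?_⟩
      split_ifs with hn
      · simpa using h n hn
      · trivial
    · rintro ⟨h1, h2⟩ i hi
      by_cases hin : i = n
      · subst hin; simpa [hi] using h2
      · simpa [Function.update_of_ne hin] using h1 i ⟨hin, hi⟩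
  rw [this, Measure.prod_prod, Measure.infinitePi_pi _ fun i _ => ht i]
  split_ifs with hn
  · rw [Finset.prod_erase_mul _ _ hn]
  · rw [measure_univ, mul_one, Finset.erase_eq_of_notMem hn]

/-- Prepend a term to a sequence. -/
def seqCons (p : α × (ℕ → α)) : ℕ → α
  | 0 => p.1
  | n + 1 => p.2 n

/-- Used to peel off the first uniform variable in the max-Dickman recursion. -/
theorem measurePreserving_seqCons :
    MeasurePreserving (seqCons (α := α)) (ν.prod (Measure.infinitePi fun _ : ℕ => ν))
      (Measure.infinitePi fun _ : ℕ => ν) := by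
  have hm : Measurable (seqCons (α := α)) := by
    refine measurable_pi_lambda _ fun i => ?_
    cases i with
    | zero => exact measurable_fst
    | succ n => exact (measurable_pi_apply n).comp measurable_snd
  refine ⟨hm, Measure.eq_infinitePi _ fun s t ht => ?_⟩
  rw [Measure.map_apply hm (MeasurableSet.pi s.countable_toSet fun i _ => ht i)]
  obtain ⟨n, hn⟩ : ∃ n, s ⊆ Finset.range (n + 1) :=
    ⟨s.sup id, fun i hi => Finset.mem_range.2 (Nat.lt_succ_of_le (Finset.le_sup (f := id) hi))⟩
  -- Padding with `Set.univ` makes the cylinder constrain a full initial segment, so that its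
  -- measure is a product over a range.
  set t' : ℕ → Set α := fun i => if i ∈ s then t i else Set.univ with ht'
  have hmt : ∀ i, MeasurableSet (t' i) := fun i => by
    simp only [ht']; split_ifs
    · exact ht i
    · exact .univ
  have : seqCons ⁻¹' (Set.pi s t) = t' 0 ×ˢ {y | ∀ i < n, y i ∈ t' (i + 1)} := by
    ext p
    simp only [Set.mem_preimage, Set.mem_pi, Finset.mem_coe, Set.mem_prod, Set.mem_ofPred_eq, ht']
    constructor
    · intro h
      refine ⟨?_, fun i _ => ?_⟩
      · split_ifs with h0
        · exact h 0 h0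
        · trivial
      · split_ifs with h0
        · exact h (i + 1) h0
        · trivial
    · rintro ⟨h1, h2⟩ i hi
      cases i with
      | zero => simp only [hi, if_true] at h1; exact h1
      | succ i =>
        have := h2 i (by simpa using hn hi)
        simp only [hi, if_true] at this
        exact this
  rw [this, Measure.prod_prod, infinitePi_forall_lt ν (s := fun i => t' (i + 1))
    (fun i => hmt _) n, mul_comm, ← Finset.prod_range_succ' (fun i => ν (t' i)),
    ← Finset.prod_subset hn (f := fun i => ν (t' i))]
  · exact Finset.prod_congr rfl fun i hi => by simp [ht', hi]
  · intro i _ hi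
    simp [ht', hi]

end InfiniteProduct

/-! ### Poisson averages of sequences -/

section PoissonMixture

theorem tendsto_poissonMeasure_real_singleton (n : ℕ) :
    Tendsto (fun r : ℝ≥0 => (poissonMeasure r).real {n}) atTop (𝓝 0) := by
  simp only [poissonMeasure_real_singleton]
  have h := ((Real.tendsto_pow_mul_exp_neg_atTop_nhds_zero n).comp
    (NNReal.tendsto_coe_atTop.2 (tendsto_id (α := ℝ≥0)))).div_const (n.factorial : ℝ)
  rw [zero_div] at h
  refine h.congr fun r => ?_
  simp [mul_comm]

theorem integrable_poissonMeasure_of_bounded {a : ℕ → ℝ} {C : ℝ} (ha : ∀ n, |a n| ≤ C) (r : ℝ≥0) :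
    Integrable a (poissonMeasure r) :=
  (integrable_const C).mono' .of_discrete (Eventually.of_forall ha)

/-- The Poisson mass of each finite set of indices vanishes as the mean grows, so only the tail of
the sequence counts. -/
theorem tendsto_integral_poissonMeasure {a : ℕ → ℝ} {C c : ℝ} (ha : ∀ n, |a n| ≤ C)
    (hc : Tendsto a atTop (𝓝 c)) :
    Tendsto (fun r : ℝ≥0 => ∫ n, a n ∂poissonMeasure r) atTop (𝓝 c) := by
  have hC : 0 ≤ C := (abs_nonneg _).trans (ha 0)
  have hcC : |c| ≤ C := le_of_tendsto' hc.abs ha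
  rw [Metric.tendsto_atTop'] at hc
  rw [tendsto_iff_norm_sub_tendsto_zero, tendsto_order]
  refine ⟨fun b hb => Eventually.of_forall fun r => hb.trans_le (norm_nonneg _), fun ε hε => ?_⟩
  obtain ⟨N, hN⟩ := hc (ε / 2) (by positivity)
  have hsum : Tendsto (fun r : ℝ≥0 => ∑ n ∈ Finset.range (N + 1),
      (2 * C) * (poissonMeasure r).real {n}) atTop (𝓝 0) := by
    simpa using tendsto_finsetSum (Finset.range (N + 1)) fun n _ =>
      (tendsto_poissonMeasure_real_singleton n).const_mul (2 * C)
  filter_upwards [hsum.eventually_lt_const (show (0 : ℝ) < ε / 2 by positivity)] with r hr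
  have hia := integrable_poissonMeasure_of_bounded ha r
  have h1 : ∫ n, a n ∂poissonMeasure r - c = ∫ n, (a n - c) ∂poissonMeasure r := by
    rw [integral_sub hia (integrable_const c)]
    simp
  rw [h1]
  -- Beyond N the distance to the limit is at most ε/2; on the remaining indices both terms are
  -- bounded by C.
  have hind : ∀ n, ‖a n - c‖ ≤ ε / 2 +
      (Finset.range (N + 1) : Set ℕ).indicator (fun _ => 2 * C) n := by
    intro n
    by_cases hn : n ∈ (Finset.range (N + 1) : Set ℕ)
    · rw [Set.indicator_of_mem hn, Real.norm_eq_abs]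
      have := abs_sub (a n) c
      linarith [ha n]
    · rw [Set.indicator_of_notMem hn, add_zero]
      have : n > N := by simpa using hn
      exact (hN n this).le
  have hint : Integrable (fun n => ε / 2 +
      (Finset.range (N + 1) : Set ℕ).indicator (fun _ => 2 * C) n) (poissonMeasure r) :=
    (integrable_const _).add ((integrable_const _).indicator (Finset.measurableSet _))
  refine (norm_integral_le_of_norm_le hint (Eventually.of_forall hind)).trans_lt ?_
  rw [integral_add (integrable_const _)
    ((integrable_const _).indicator (Finset.measurableSet _)),
    integral_indicator_const _ (Finset.measurableSet _)]
  have h2 : (poissonMeasure r).real (Finset.range (N + 1) : Set ℕ) =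
      ∑ n ∈ Finset.range (N + 1), (poissonMeasure r).real {n} := by
    rw [sum_measureReal_singleton]
  rw [h2]
  rw [← Finset.mul_sum] at hr
  simp only [integral_const, probReal_univ, smul_eq_mul, one_mul]
  linarith

/-- The probability generating function of the Poisson distribution. -/
theorem lintegral_pow_poissonMeasure (r p : ℝ≥0) (hp : p ≤ 1) :
    ∫⁻ n, ((1 - p : ℝ≥0) : ℝ≥0∞) ^ n ∂poissonMeasure r = poissonMeasure (r * p) {0} := by
  rw [poissonMeasure, lintegral_sum_measure]
  simp only [lintegral_smul_measure, lintegral_dirac, smul_eq_mul]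
  have h1 : ∀ n : ℕ, ENNReal.ofReal (Real.exp (-r) * r ^ n / n.factorial) *
      ((1 - p : ℝ≥0) : ℝ≥0∞) ^ n =
      ENNReal.ofReal (Real.exp (-(r : ℝ)) * (((r : ℝ) * (1 - p)) ^ n / n.factorial)) := by
    intro n
    rw [← ENNReal.coe_pow, ENNReal.ofReal, ← ENNReal.coe_mul, ENNReal.ofReal]
    congr 1
    rw [← Real.toNNReal_coe (r := (1 - p) ^ n), ← Real.toNNReal_mul (by positivity)]
    congr 1
    push_cast [NNReal.coe_sub hp]
    rw [mul_pow]
    ring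
  simp only [h1]
  have hs : HasSum (fun n : ℕ => Real.exp (-(r : ℝ)) * (((r : ℝ) * (1 - p)) ^ n / n.factorial))
      (Real.exp (-(r : ℝ)) * Real.exp (r * (1 - p))) := by
    rw [Real.exp_eq_exp_ℝ]
    exact (NormedSpace.expSeries_div_hasSum_exp ((r : ℝ) * (1 - p))).mul_left _
  have hp' : (0 : ℝ) ≤ 1 - p := sub_nonneg.2 (by exact_mod_cast hp)
  rw [← ENNReal.ofReal_tsum_of_nonneg (fun n => by positivity) hs.summable, hs.tsum_eq,
    poissonMeasure_singleton, ← Real.exp_add]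
  congr 1
  push_cast
  simp
  ring

end PoissonMixture


/-! ### Convergence of the on-line nearest-neighbour graph -/

section Ong

/-- The law of a sequence of independent uniform points of the cube. -/
noncomputable def uniformSeq (k : ℕ) : Measure (ℕ → EuclideanSpace ℝ (Fin k)) :=
  Measure.infinitePi fun _ : ℕ => uniformCube k

instance isProbabilityMeasure_uniformSeq (k : ℕ) : IsProbabilityMeasure (uniformSeq k) := by
  unfold uniformSeq; infer_instance

theorem ae_uniformSeq_mem_openCube (k : ℕ) :
    ∀ᵐ y ∂uniformSeq k, ∀ i, y i ∈ openCube k :=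
  ae_forall_infinitePi _ (ae_mem_openCube k)

/-- The supremum of the edge lengths of the on-line nearest-neighbour graph on a whole sequence. -/
noncomputable def ongSup {k : ℕ} (y : ℕ → EuclideanSpace ℝ (Fin k)) : ℝ :=
  ⨆ m, ongLongestEdge y m

theorem measurable_ongSup (k : ℕ) :
    Measurable (ongSup : (ℕ → EuclideanSpace ℝ (Fin k)) → ℝ) :=
  Measurable.iSup measurable_ongLongestEdge

theorem bddAbove_ongLongestEdge {k : ℕ} {y : ℕ → EuclideanSpace ℝ (Fin k)}
    (hy : ∀ i, y i ∈ openCube k) : BddAbove (Set.range (ongLongestEdge y)) :=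
  ⟨k, by rintro _ ⟨m, rfl⟩; exact ongLongestEdge_le_of_mem_openCube hy m⟩

theorem tendsto_ongLongestEdge {k : ℕ} {y : ℕ → EuclideanSpace ℝ (Fin k)}
    (hy : ∀ i, y i ∈ openCube k) :
    Tendsto (ongLongestEdge y) atTop (𝓝 (ongSup y)) :=
  tendsto_atTop_ciSup (ongLongestEdge_mono y) (bddAbove_ongLongestEdge hy)

/-- The law of the supremum of the edge lengths of the on-line nearest-neighbour graph on
independent uniform points. -/
noncomputable def ongSupLaw (k : ℕ) : ProbabilityMeasure ℝ :=
  ⟨(uniformSeq k).map ongSup, Measure.isProbabilityMeasure_map (measurable_ongSup k).aemeasurable⟩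

/-- The law of the longest edge of the on-line nearest-neighbour graph on `n` points. -/
noncomputable def ongLaw (k n : ℕ) : ProbabilityMeasure ℝ :=
  ⟨(uniformSeq k).map fun y => ongLongestEdge y n,
    Measure.isProbabilityMeasure_map (measurable_ongLongestEdge n).aemeasurable⟩

theorem measurable_ongLongestEdge_uncurry (k : ℕ) :
    Measurable fun p : ℕ × (ℕ → EuclideanSpace ℝ (Fin k)) => ongLongestEdge p.2 p.1 :=
  measurable_from_prod_countable_right measurable_ongLongestEdge

/-- The law of the longest edge of the on-line nearest-neighbour graph on a Poisson number of
points. -/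
noncomputable def ongPoissonLaw (k : ℕ) (r : ℝ≥0) : ProbabilityMeasure ℝ :=
  ⟨((poissonMeasure r).prod (uniformSeq k)).map fun p => ongLongestEdge p.2 p.1,
    Measure.isProbabilityMeasure_map (measurable_ongLongestEdge_uncurry k).aemeasurable⟩

/-- Dominated convergence along the almost sure monotone limit of the longest edges. -/
theorem tendsto_integral_ongLongestEdge (k : ℕ) {f : ℝ → ℝ} (hf : Continuous f) {C : ℝ}
    (hC : ∀ x, |f x| ≤ C) :
    Tendsto (fun n => ∫ y, f (ongLongestEdge y n) ∂uniformSeq k) atTop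
      (𝓝 (∫ y, f (ongSup y) ∂uniformSeq k)) := by
  refine tendsto_integral_of_dominated_convergence (fun _ => C)
    (fun n => (hf.measurable.comp (measurable_ongLongestEdge n)).aestronglyMeasurable)
    (integrable_const _) (fun n => Eventually.of_forall fun y => hC _) ?_
  filter_upwards [ae_uniformSeq_mem_openCube k] with y hy
  exact (hf.tendsto _).comp (tendsto_ongLongestEdge hy)

theorem abs_integral_le_of_forall_abs_le {α : Type*} [MeasurableSpace α] (μ : Measure α)
    [IsProbabilityMeasure μ] {f : α → ℝ} {C : ℝ} (hC : ∀ x, |f x| ≤ C) : |∫ x, f x ∂μ| ≤ C := by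
  simpa using norm_integral_le_of_norm_le_const (μ := μ) (f := f) (Eventually.of_forall hC)

theorem integral_ongPoissonLaw (k : ℕ) (r : ℝ≥0) {f : ℝ → ℝ} (hf : Continuous f) {C : ℝ}
    (hC : ∀ x, |f x| ≤ C) :
    ∫ x, f x ∂(ongPoissonLaw k r : Measure ℝ) =
      ∫ n, ∫ y, f (ongLongestEdge y n) ∂uniformSeq k ∂poissonMeasure r := by
  have hm := measurable_ongLongestEdge_uncurry k
  rw [ongPoissonLaw, ProbabilityMeasure.coe_mk,
    integral_map hm.aemeasurable hf.aestronglyMeasurable, integral_prod]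
  exact (integrable_const C).mono' (hf.measurable.comp hm).aestronglyMeasurable
    (Eventually.of_forall fun p => hC _)

theorem tendsto_ongLaw (k : ℕ) : Tendsto (ongLaw k) atTop (𝓝 (ongSupLaw k)) := by
  rw [ProbabilityMeasure.tendsto_iff_forall_integral_tendsto]
  intro f
  have := tendsto_integral_ongLongestEdge k f.continuous fun x => f.norm_coe_le_norm x
  rw [ongSupLaw, ProbabilityMeasure.coe_mk, integral_map (measurable_ongSup k).aemeasurable
    f.continuous.aestronglyMeasurable]
  refine this.congr fun n => ?_
  rw [ongLaw, ProbabilityMeasure.coe_mk, integral_map (measurable_ongLongestEdge n).aemeasurable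
    f.continuous.aestronglyMeasurable]

theorem tendsto_integral_ongPoissonLaw (k : ℕ) {f : ℝ → ℝ} (hf : Continuous f) {C : ℝ}
    (hC : ∀ x, |f x| ≤ C) :
    Tendsto (fun r => ∫ x, f x ∂(ongPoissonLaw k r : Measure ℝ)) atTop
      (𝓝 (∫ x, f x ∂(ongSupLaw k : Measure ℝ))) := by
  simp only [integral_ongPoissonLaw k _ hf hC]
  rw [ongSupLaw, ProbabilityMeasure.coe_mk, integral_map (measurable_ongSup k).aemeasurable
    hf.aestronglyMeasurable]
  exact tendsto_integral_poissonMeasure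
    (fun n => abs_integral_le_of_forall_abs_le _ fun y => hC _)
    (tendsto_integral_ongLongestEdge k hf hC)

theorem tendsto_ongPoissonLaw (k : ℕ) : Tendsto (ongPoissonLaw k) atTop (𝓝 (ongSupLaw k)) := by
  rw [ProbabilityMeasure.tendsto_iff_forall_integral_tendsto]
  exact fun f => tendsto_integral_ongPoissonLaw k f.continuous fun x => f.norm_coe_le_norm x

/-- Convergence in distribution involves only the laws, so the probability space may change with the
index; the limit variable is the identity on ℝ under Q. -/
theorem tendstoInDistribution_of_map_eq {ι κ : Type*} {l : Filter ι} {l' : Filter κ}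
    {Ω : ι → Type*} [∀ i, MeasurableSpace (Ω i)] {μ : ∀ i, Measure (Ω i)}
    [∀ i, IsProbabilityMeasure (μ i)] {X : ∀ i, Ω i → ℝ} (hX : ∀ i, AEMeasurable (X i) (μ i))
    {ν : κ → ProbabilityMeasure ℝ} {Q : ProbabilityMeasure ℝ} (hν : Tendsto ν l' (𝓝 Q))
    {r : ι → κ} (hr : Tendsto r l l') (h : ∀ i, (μ i).map (X i) = ν (r i)) :
    TendstoInDistribution X l (fun q : ℝ => q) μ (Q : Measure ℝ) where
  forall_aemeasurable := hX
  aemeasurable_limit := aemeasurable_id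
  tendsto := by
    have hQ : (⟨(Q : Measure ℝ).map fun q => q, Measure.isProbabilityMeasure_map aemeasurable_id⟩ :
        ProbabilityMeasure ℝ) = Q := Subtype.ext Measure.map_id
    rw [hQ]
    refine (hν.comp hr).congr fun i => ?_
    exact Subtype.ext (h i).symm

theorem tendstoInDistribution_ongLongestEdge {k : ℕ} {Ω : Type*} [MeasurableSpace Ω]
    (μ : Measure Ω) [IsProbabilityMeasure μ] (U : ℕ → Ω → EuclideanSpace ℝ (Fin k))
    (hU : ∀ j, HasLaw (U j) (uniformCube k) μ) (hind : iIndepFun U μ) :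
    TendstoInDistribution (fun (n : ℕ) ω => ongLongestEdge (fun j => U j ω) n) atTop
      (fun q : ℝ => q) (fun _ => μ) (ongSupLaw k : Measure ℝ) := by
  have hm : AEMeasurable (fun ω j => U j ω) μ := aemeasurable_pi_iff.2 fun j => (hU j).aemeasurable
  have hlaw := hind.hasLaw_infinitePi hU hm
  refine tendstoInDistribution_of_map_eq
    (fun n => (measurable_ongLongestEdge n).comp_aemeasurable hm) (tendsto_ongLaw k) tendsto_id
    fun n => ?_
  rw [ongLaw, ProbabilityMeasure.coe_mk, uniformSeq, ← hlaw.map_eq, id,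
    AEMeasurable.map_map_of_aemeasurable (measurable_ongLongestEdge n).aemeasurable hm]

theorem tendstoInDistribution_ongLongestEdge_poisson {k : ℕ} {ι : Type*} (l : Filter ι)
    (r : ι → ℝ≥0) (hr : Tendsto r l atTop) {Ω : Type*} [MeasurableSpace Ω]
    (μ : Measure Ω) [IsProbabilityMeasure μ] (U : ℕ → Ω → EuclideanSpace ℝ (Fin k))
    (N : ι → Ω → ℕ) (hU : ∀ j, HasLaw (U j) (uniformCube k) μ) (hind : iIndepFun U μ)
    (hN : ∀ i, HasLaw (N i) (poissonMeasure (r i)) μ)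
    (hNU : ∀ i, IndepFun (N i) (fun ω j => U j ω) μ) :
    TendstoInDistribution (fun i ω => ongLongestEdge (fun j => U j ω) (N i ω)) l
      (fun q : ℝ => q) (fun _ => μ) (ongSupLaw k : Measure ℝ) := by
  have hm : AEMeasurable (fun ω j => U j ω) μ := aemeasurable_pi_iff.2 fun j => (hU j).aemeasurable
  have hlaw := hind.hasLaw_infinitePi hU hm
  have hm2 : ∀ i, AEMeasurable (fun ω => (N i ω, fun j => U j ω)) μ := fun i =>
    (hN i).aemeasurable.prodMk hm
  have hmO := measurable_ongLongestEdge_uncurry k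
  refine tendstoInDistribution_of_map_eq
    (fun i => hmO.comp_aemeasurable (hm2 i)) (tendsto_ongPoissonLaw k) hr
    fun i => ?_
  have hprod := (indepFun_iff_map_prod_eq_prod_map_map (hN i).aemeasurable hm).1 (hNU i)
  rw [ongPoissonLaw, ProbabilityMeasure.coe_mk, uniformSeq, ← hlaw.map_eq, ← (hN i).map_eq, ← hprod,
    AEMeasurable.map_map_of_aemeasurable hmO.aemeasurable (hm2 i)]

end Ong


/-! ### Pairs of i.i.d. sequences and sorting -/

section PairedSequences

variable {α β : Type*} [MeasurableSpace α] [MeasurableSpace β] (ν₁ : Measure α) (ν₂ : Measure β)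
  [IsProbabilityMeasure ν₁] [IsProbabilityMeasure ν₂]

theorem measurableSet_forall_lt_mem {C : Set (α × β)} (hC : MeasurableSet C) (n : ℕ) :
    MeasurableSet {p : (ℕ → β) × (ℕ → α) | ∀ j < n, (p.2 j, p.1 j) ∈ C} := by
  simp only [Set.ofPred_forall]
  refine MeasurableSet.iInter fun j => MeasurableSet.iInter fun _ => ?_
  have : Measurable fun p : (ℕ → β) × (ℕ → α) => (p.2 j, p.1 j) := by fun_prop
  exact this hC

/-- Pairs formed from two independent i.i.d. sequences are i.i.d. -/
theorem prod_infinitePi_forall_lt_mem {C : Set (α × β)} (hC : MeasurableSet C) (n : ℕ) :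
    ((Measure.infinitePi fun _ : ℕ => ν₂).prod (Measure.infinitePi fun _ : ℕ => ν₁))
      {p | ∀ j < n, (p.2 j, p.1 j) ∈ C} = (ν₁.prod ν₂ C) ^ n := by
  rw [Measure.prod_apply (measurableSet_forall_lt_mem hC n)]
  have hslice : ∀ t, MeasurableSet ((fun v => (v, t)) ⁻¹' C) := fun t =>
    (measurable_id.prodMk measurable_const) hC
  have hg : Measurable fun t => ν₁ ((fun v => (v, t)) ⁻¹' C) :=
    measurable_measure_prodMk_right hC
  have h1 : ∀ T : ℕ → β, (Measure.infinitePi fun _ : ℕ => ν₁)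
      (Prod.mk T ⁻¹' {p : (ℕ → β) × (ℕ → α) | ∀ j < n, (p.2 j, p.1 j) ∈ C}) =
      ∏ j ∈ Finset.range n, ν₁ ((fun v => (v, T j)) ⁻¹' C) := fun T =>
    infinitePi_forall_lt ν₁ (s := fun j => (fun v => (v, T j)) ⁻¹' C) (fun j => hslice _) n
  simp only [h1]
  -- For fixed T the probability is a product over j; its factors are independent functions of the
  -- coordinates of T, so the mean of the product factorises.
  have hind : iIndepFun (fun (j : ℕ) (T : ℕ → β) => ν₁ ((fun v => (v, T j)) ⁻¹' C))
      (Measure.infinitePi fun _ : ℕ => ν₂) :=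
    iIndepFun_infinitePi (P := fun _ : ℕ => ν₂)
      (X := fun (_ : ℕ) t => ν₁ ((fun v => (v, t)) ⁻¹' C)) fun _ => hg
  rw [lintegral_prod_eq_prod_lintegral_of_indepFun (Finset.range n) _ hind
    fun j => hg.comp (measurable_pi_apply j)]
  have h2 : ∀ j : ℕ, ∫⁻ T : ℕ → β, ν₁ ((fun v => (v, T j)) ⁻¹' C)
      ∂(Measure.infinitePi fun _ : ℕ => ν₂) = ν₁.prod ν₂ C := fun j => by
    rw [Measure.prod_apply_symm hC]
    exact (measurePreserving_eval_infinitePi (fun _ : ℕ => ν₂) j).lintegral_comp hg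
  simp [h2]

/-- The diagonal is null for an atomless law, by Fubini. Applied to heights, it rules out ties. -/
theorem ae_injective_infinitePi [NullSingletonClass ν₁] [MeasurableSingletonClass α] [MeasurableEq α] :
    ∀ᵐ y ∂Measure.infinitePi (fun _ : ℕ => ν₁), Function.Injective y := by
  have h : ∀ᵐ y ∂Measure.infinitePi (fun _ : ℕ => ν₁), ∀ i j, i ≠ j → y i ≠ y j := by
    simp only [ae_all_iff]
    intro i j hij
    have hmap := Measure.infinitePi_map_eval_prod (P := fun _ : ℕ => ν₁) hij
    have hd : ∀ᵐ p ∂ν₁.prod ν₁, p.1 ≠ p.2 := by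
      rw [ae_iff]
      have : {p : α × α | ¬ p.1 ≠ p.2} = Set.diagonal α := by ext; simp
      rw [this, Measure.prod_apply measurableSet_diagonal]
      have : ∀ x, Prod.mk x ⁻¹' Set.diagonal α = {x} := fun x => by ext; simp [eq_comm]
      simp [this]
    rw [← hmap] at hd
    have hm : AEMeasurable (fun y : ℕ → α => (y i, y j)) (Measure.infinitePi fun _ : ℕ => ν₁) := by
      fun_prop
    exact ae_of_ae_map hm hd
  filter_upwards [h] with y hy i j hij
  by_contra hne
  exact hy i j hne hij

end PairedSequences

theorem exists_sorting (T : ℕ → ℝ) (hT : Function.Injective T) (n : ℕ) :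
    ∃ σ : ℕ → ℕ, Function.Injective σ ∧ (Finset.range n).image σ = Finset.range n ∧
      StrictMonoOn (T ∘ σ) (Set.Iio n) := by
  set s : Equiv.Perm (Fin n) := Tuple.sort fun i : Fin n => T i with hs
  have hmono : Monotone ((fun i : Fin n => T i) ∘ s) := Tuple.monotone_sort _
  -- The sorting permutation of the first n indices is extended by the identity: injectivity on all
  -- of ℕ is what preserves the law of an infinite i.i.d. sequence.
  set σ : ℕ → ℕ := fun j => if h : j < n then s ⟨j, h⟩ else j with hσ
  have hlt : ∀ j (h : j < n), σ j = s ⟨j, h⟩ := fun j h => by simp [hσ, h]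
  have hge : ∀ j, n ≤ j → σ j = j := fun j h => by simp [hσ, not_lt.2 h]
  have hσlt : ∀ j < n, σ j < n := fun j h => by rw [hlt j h]; exact (s _).2
  have hinj : Function.Injective σ := by
    intro i j hij
    rcases lt_or_ge i n with hi | hi <;> rcases lt_or_ge j n with hj | hj
    · rw [hlt i hi, hlt j hj] at hij
      simpa using s.injective (Fin.ext hij)
    · have := hσlt i hi; rw [hij, hge j hj] at this; omega
    · have := hσlt j hj; rw [← hij, hge i hi] at this; omega
    · rwa [hge i hi, hge j hj] at hij
  refine ⟨σ, hinj, ?_, ?_⟩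
  · refine Finset.eq_of_subset_of_card_le ?_ ?_
    · intro j hj
      obtain ⟨i, hi, rfl⟩ := Finset.mem_image.1 hj
      exact Finset.mem_range.2 (hσlt i (Finset.mem_range.1 hi))
    · rw [Finset.card_image_of_injective _ hinj]
  · intro i hi j hj hij
    refine lt_of_le_of_ne ?_ fun h => hij.ne (hinj (hT h))
    have := hmono (show (⟨i, hi⟩ : Fin n) ≤ ⟨j, hj⟩ from hij.le)
    simpa [hlt i hi, hlt j hj] using this

/-! ### Occupied grid cells -/

section Cells

/-- The open cell with lower corner `c / (M + 1)` of the grid of mesh `1 / (M + 1)`. -/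
def openCell {d : ℕ} (M : ℕ) (c : Fin d → Fin (M + 1)) : Set (EuclideanSpace ℝ (Fin d)) :=
  {x | ∀ i, ((M : ℝ) + 1) * x i ∈ Set.Ioo (c i : ℝ) (c i + 1)}

theorem isOpen_openCell {d : ℕ} (M : ℕ) (c : Fin d → Fin (M + 1)) : IsOpen (openCell M c) := by
  simp only [openCell, Set.ofPred_forall]
  refine isOpen_iInter_of_finite fun i => ?_
  have : Continuous fun x : EuclideanSpace ℝ (Fin d) => ((M : ℝ) + 1) * x i := by fun_prop
  exact isOpen_Ioo.preimage this

theorem openCell_subset_openCube {d : ℕ} (M : ℕ) (c : Fin d → Fin (M + 1)) :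
    openCell M c ⊆ openCube d := by
  intro x hx i
  obtain ⟨h1, h2⟩ := hx i
  have hM : (0 : ℝ) < (M : ℝ) + 1 := by positivity
  have h3 : ((c i : ℕ) : ℝ) + 1 ≤ (M : ℝ) + 1 := by exact_mod_cast (c i).2
  have h4 : (0 : ℝ) ≤ ((c i : ℕ) : ℝ) := by positivity
  constructor
  · by_contra h
    nlinarith
  · by_contra h
    nlinarith

theorem uniformCube_openCell_pos {d : ℕ} (M : ℕ) (c : Fin d → Fin (M + 1)) :
    0 < uniformCube d (openCell M c) := by
  rw [uniformCube, Measure.restrict_apply (isOpen_openCell M c).measurableSet,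
    Set.inter_eq_left.2 (openCell_subset_openCube M c)]
  refine (isOpen_openCell M c).measure_pos _ ⟨WithLp.toLp 2 fun i => ((c i : ℝ) + 1 / 2) / (M + 1),
    fun i => ?_⟩
  have hM : (0 : ℝ) < (M : ℝ) + 1 := by positivity
  have : ((M : ℝ) + 1) * (((c i : ℝ) + 1 / 2) / (M + 1)) = (c i : ℝ) + 1 / 2 := by
    field_simp
  simp only [this, Set.mem_Ioo]
  constructor <;> linarith

/-- If all open cells of the grid are occupied, then every point that is not in the lowest layer
has a lower point nearby. -/
theorem exists_lower_near_of_cells {k n M : ℕ} {X : ℕ → EuclideanSpace ℝ (Fin (k + 1))}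
    (hX : ∀ j, X j ∈ openCube (k + 1))
    (hcell : ∀ c : Fin (k + 1) → Fin (M + 1), ∃ j < n, X j ∈ openCell M c) (i : ℕ)
    (hi : 1 / ((M : ℝ) + 1) ≤ X i (Fin.last k)) :
    ∃ j < n, X j (Fin.last k) < X i (Fin.last k) ∧
      ‖X j - X i‖ ≤ ((k + 1 : ℕ) : ℝ) * (2 / ((M : ℝ) + 1)) := by
  have hM : (0 : ℝ) < (M : ℝ) + 1 := by positivity
  have hnn : ∀ l, 0 ≤ ((M : ℝ) + 1) * X i l := fun l => mul_nonneg hM.le (hX i l).1.le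
  have hfl : ∀ l, ⌊((M : ℝ) + 1) * X i l⌋₊ < M + 1 := fun l => by
    rw [Nat.floor_lt (hnn l)]
    push_cast
    nlinarith [(hX i l).2]
  -- The cell directly below the one containing `X i`. The height assumption makes the last floor at
  -- least 1, so the natural subtraction does not truncate.
  set c : Fin (k + 1) → Fin (M + 1) := fun l =>
    ⟨if l = Fin.last k then ⌊((M : ℝ) + 1) * X i l⌋₊ - 1 else ⌊((M : ℝ) + 1) * X i l⌋₊, by
      split_ifs
      · exact (Nat.sub_le _ _).trans_lt (hfl l)
      · exact hfl l⟩ with hc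
  obtain ⟨j, hj, hjc⟩ := hcell c
  have hl1 := fun l => Nat.floor_le (hnn l)
  have hl2 := fun l => Nat.lt_floor_add_one (((M : ℝ) + 1) * X i l)
  have h1 : 1 ≤ ⌊((M : ℝ) + 1) * X i (Fin.last k)⌋₊ := by
    rw [Nat.le_floor_iff (hnn _)]
    rw [div_le_iff₀ hM] at hi
    push_cast
    linarith
  have hlast := hjc (Fin.last k)
  simp only [hc, if_true, Set.mem_Ioo, Nat.cast_sub h1, Nat.cast_one, sub_add_cancel] at hlast
  refine ⟨j, hj, ?_, ?_⟩
  · have := hlast.2.trans_le (hl1 _)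
    exact lt_of_mul_lt_mul_left this hM.le
  -- In mesh units the horizontal coordinates differ by at most 1 and the heights by at most 2,
  -- whence the constant 2/(M+1).
  · refine norm_le_of_forall_abs_le _ fun l => ?_
    rw [PiLp.sub_apply, le_div_iff₀ hM, ← abs_of_pos hM, ← abs_mul, abs_le]
    by_cases hl : l = Fin.last k
    · subst hl
      have a1 := hl1 (Fin.last k)
      have a2 := hl2 (Fin.last k)
      constructor <;> nlinarith [hlast.1, hlast.2]
    · have hcl := hjc l
      simp only [hc, hl, if_false, Set.mem_Ioo] at hcl
      have a1 := hl1 l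
      have a2 := hl2 l
      constructor <;> nlinarith [hcl.1, hcl.2]

end Cells


/-! ### A concrete Poisson process -/

section CanonicalProcess

/-- Sample space of the canonical Poisson process: number of points, sequence of heights, sequence
of projections. -/
abbrev PoissonSample (k : ℕ) : Type := (ℕ × (ℕ → ℝ)) × (ℕ → EuclideanSpace ℝ (Fin k))

/-- The law of the canonical Poisson process. -/
noncomputable def poissonSampleLaw (k : ℕ) (r : ℝ≥0) : Measure (PoissonSample k) :=
  ((poissonMeasure r).prod (Measure.infinitePi fun _ : ℕ => uniform01)).prod (uniformSeq k)

instance isProbabilityMeasure_poissonSampleLaw (k : ℕ) (r : ℝ≥0) :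
    IsProbabilityMeasure (poissonSampleLaw k r) := by
  unfold poissonSampleLaw; infer_instance

/-- The `j`-th potential point. -/
noncomputable def samplePoint {k : ℕ} (p : PoissonSample k) (j : ℕ) :
    EuclideanSpace ℝ (Fin (k + 1)) :=
  appendLast (p.2 j, p.1.2 j)

open scoped Classical in
/-- The points of the canonical Poisson process. -/
noncomputable def samplePoints {k : ℕ} (p : PoissonSample k) :
    Finset (EuclideanSpace ℝ (Fin (k + 1))) :=
  ((Finset.range p.1.1).image (samplePoint p)).filter (· ∈ openCube (k + 1))

/-- The filter in `samplePoints` makes this true at every sample, not just almost surely, as the law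
comparison requires. -/
theorem samplePoints_subset {k : ℕ} (p : PoissonSample k) :
    (samplePoints p : Set (EuclideanSpace ℝ (Fin (k + 1)))) ⊆ openCube (k + 1) := by
  intro x hx
  simp only [samplePoints, Finset.coe_filter, Set.mem_ofPred_eq] at hx
  exact hx.2

theorem measurableSet_samplePoint_mem {k : ℕ} {C : Set (EuclideanSpace ℝ (Fin (k + 1)))}
    (hC : MeasurableSet C) :
    MeasurableSet {p : PoissonSample k | ∀ j < p.1.1, samplePoint p j ∈ C} := by
  have h : {p : PoissonSample k | ∀ j < p.1.1, samplePoint p j ∈ C} =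
      ⋂ j, ({p : PoissonSample k | j < p.1.1}ᶜ ∪ {p : PoissonSample k | samplePoint p j ∈ C}) := by
    ext p
    simp only [Set.mem_ofPred_eq, Set.mem_iInter, Set.mem_union, Set.mem_compl_iff, imp_iff_not_or]
  rw [h]
  refine MeasurableSet.iInter fun j => MeasurableSet.union ?_ ?_
  · have : Measurable fun p : PoissonSample k => p.1.1 := by fun_prop
    exact (this (measurableSet_Ioi (a := j))).compl
  · have h1 : Measurable fun p : PoissonSample k => (p.2 j, p.1.2 j) := by fun_prop
    exact ((measurePreserving_appendLast k).measurable.comp h1) hC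

/-- Avoidance probabilities of the canonical Poisson process. -/
theorem poissonSampleLaw_forall_mem {k : ℕ} (r : ℝ≥0)
    {C : Set (EuclideanSpace ℝ (Fin (k + 1)))} (hC : MeasurableSet C) :
    poissonSampleLaw k r {p | ∀ j < p.1.1, samplePoint p j ∈ C} =
      poissonMeasure (r * (uniformCube (k + 1) Cᶜ).toNNReal) {0} := by
  have hm := measurableSet_samplePoint_mem hC
  have hC' := (measurePreserving_appendLast k).measurable hC
  have hassoc := (measurePreserving_prodAssoc (poissonMeasure r)
    (Measure.infinitePi fun _ : ℕ => uniform01) (uniformSeq k)).symm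
  rw [poissonSampleLaw, ← hassoc.measure_preimage hm.nullMeasurableSet,
    Measure.prod_apply (hassoc.measurable hm)]
  -- Given n points, each lies in C independently with probability 1 - p, where p is the volume of
  -- the complement; the Poisson generating function then averages over n.
  have h1 : ∀ n : ℕ, ((Measure.infinitePi fun _ : ℕ => uniform01).prod (uniformSeq k))
      (Prod.mk n ⁻¹' (MeasurableEquiv.prodAssoc.symm ⁻¹'
        {p : PoissonSample k | ∀ j < p.1.1, samplePoint p j ∈ C})) =
      ((1 - (uniformCube (k + 1) Cᶜ).toNNReal : ℝ≥0) : ℝ≥0∞) ^ n := by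
    intro n
    have h2 := prod_infinitePi_forall_lt_mem (uniformCube k) uniform01 hC' n
    rw [(measurePreserving_appendLast k).measure_preimage hC.nullMeasurableSet] at h2
    have h3 : uniformCube (k + 1) C =
        ((1 - (uniformCube (k + 1) Cᶜ).toNNReal : ℝ≥0) : ℝ≥0∞) := by
      rw [ENNReal.coe_sub, ENNReal.coe_toNNReal (measure_ne_top _ _), ENNReal.coe_one,
        ← prob_compl_eq_one_sub hC.compl, compl_compl]
    rw [← h3, ← h2]
    rfl
  rw [lintegral_congr h1]
  refine lintegral_pow_poissonMeasure r _ ?_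
  rw [← ENNReal.coe_le_coe, ENNReal.coe_toNNReal (measure_ne_top _ _)]
  exact prob_le_one

theorem setOf_samplePoints_avoid {k : ℕ} (B : Set (EuclideanSpace ℝ (Fin (k + 1)))) :
    {p : PoissonSample k | ∀ x ∈ samplePoints p, x ∉ B} =
      {p | ∀ j < p.1.1, samplePoint p j ∈ (B ∩ openCube (k + 1))ᶜ} := by
  ext p
  simp only [samplePoints, Finset.mem_filter, Finset.mem_image, Finset.mem_range,
    Set.mem_ofPred_eq, Set.mem_compl_iff, Set.mem_inter_iff, not_and]
  constructor
  · intro h j hj hB hc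
    exact h _ ⟨⟨j, hj, rfl⟩, hc⟩ hB
  · rintro h x ⟨⟨j, hj, rfl⟩, hc⟩ hB
    exact h j hj hB hc

theorem measurableSet_samplePoints_avoid {k : ℕ} {B : Set (EuclideanSpace ℝ (Fin (k + 1)))}
    (hB : MeasurableSet B) : MeasurableSet {p : PoissonSample k | ∀ x ∈ samplePoints p, x ∉ B} := by
  rw [setOf_samplePoints_avoid]
  exact measurableSet_samplePoint_mem (hB.inter (measurableSet_openCube _)).compl

theorem poissonSampleLaw_avoid {k : ℕ} (r : ℝ≥0) {B : Set (EuclideanSpace ℝ (Fin (k + 1)))}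
    (hB : MeasurableSet B) :
    poissonSampleLaw k r {p | ∀ x ∈ samplePoints p, x ∉ B} =
      poissonMeasure (r * (uniformCube (k + 1) B).toNNReal) {0} := by
  rw [setOf_samplePoints_avoid,
    poissonSampleLaw_forall_mem r (hB.inter (measurableSet_openCube _)).compl, compl_compl]
  congr 4
  rw [uniformCube, Measure.restrict_apply (hB.inter (measurableSet_openCube _)),
    Measure.restrict_apply hB, Set.inter_assoc, Set.inter_self]

theorem setOf_avoid_eq_count {E Ω : Type*} (P : Ω → Finset E) (B : Set E) :
    {ω | ∀ x ∈ P ω, x ∉ B} = (fun ω => count (P ω) B) ⁻¹' {0} := by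
  ext ω
  simp only [Set.mem_ofPred_eq, Set.mem_preimage, Set.mem_singleton_iff, count]
  rw [Set.ncard_eq_zero ((P ω).finite_toSet.inter_of_left B), Set.eq_empty_iff_forall_notMem]
  simp

theorem measurable_southLongestEdge_samplePoints (k : ℕ) :
    Measurable fun p : PoissonSample k => southLongestEdge (samplePoints p) :=
  measurable_southLongestEdge samplePoints_subset fun _ => measurableSet_samplePoints_avoid

/-- The law of the longest edge of the South tree on the canonical Poisson process. -/
noncomputable def southLaw (k : ℕ) (r : ℝ≥0) : ProbabilityMeasure ℝ :=
  ⟨(poissonSampleLaw k r).map fun p => southLongestEdge (samplePoints p),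
    Measure.isProbabilityMeasure_map (measurable_southLongestEdge_samplePoints k).aemeasurable⟩

theorem IsPoissonProcess.measurableSet_avoid {d : ℕ} {r : ℝ≥0} {Ω : Type*} [MeasurableSpace Ω]
    {P : Ω → Finset (EuclideanSpace ℝ (Fin d))} {μ : Measure Ω} (hP : IsPoissonProcess r P μ)
    {B : Set (EuclideanSpace ℝ (Fin d))} (hB : MeasurableSet B) :
    MeasurableSet {ω | ∀ x ∈ P ω, x ∉ B} := by
  rw [setOf_avoid_eq_count]
  exact hP.measurable_count B hB (measurableSet_singleton 0)

theorem IsPoissonProcess.map_southLongestEdge {k : ℕ} {r : ℝ≥0} {Ω : Type*} [MeasurableSpace Ω]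
    {P : Ω → Finset (EuclideanSpace ℝ (Fin (k + 1)))} {μ : Measure Ω} [IsProbabilityMeasure μ]
    (hP : IsPoissonProcess r P μ) :
    μ.map (fun ω => southLongestEdge (P ω)) = southLaw k r := by
  refine map_southLongestEdge_eq hP.subset_cube samplePoints_subset
    (fun _ => hP.measurableSet_avoid) (fun _ => measurableSet_samplePoints_avoid) fun B hB => ?_
  rw [poissonSampleLaw_avoid r hB, setOf_avoid_eq_count, ← hP.map_count B hB,
    Measure.map_apply (hP.measurable_count B hB) (measurableSet_singleton 0)]

end CanonicalProcess

/-! ### The South tree compared with the on-line graph -/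

section Comparison

/-- The event that some open cell of the grid of mesh `1 / (M + 1)` is empty. -/
def someCellEmpty (k M : ℕ) : Set (PoissonSample k) :=
  ⋃ c : Fin (k + 1) → Fin (M + 1), {p | ∀ j < p.1.1, samplePoint p j ∈ (openCell M c)ᶜ}

theorem measurableSet_someCellEmpty (k M : ℕ) : MeasurableSet (someCellEmpty k M) :=
  MeasurableSet.iUnion fun c =>
    measurableSet_samplePoint_mem (isOpen_openCell M c).measurableSet.compl

/-- Union bound over the finitely many cells: each has positive volume, so its expected number of
points tends to infinity with r. -/
theorem tendsto_poissonSampleLaw_someCellEmpty (k M : ℕ) :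
    Tendsto (fun r => (poissonSampleLaw k r).real (someCellEmpty k M)) atTop (𝓝 0) := by
  have hle : ∀ r, (poissonSampleLaw k r).real (someCellEmpty k M) ≤
      ∑ c : Fin (k + 1) → Fin (M + 1),
        (poissonMeasure (r * (uniformCube (k + 1) (openCell M c)).toNNReal)).real {0} := by
    intro r
    refine (measureReal_iUnion_fintype_le _).trans (le_of_eq (Finset.sum_congr rfl fun c _ => ?_))
    rw [measureReal_def, poissonSampleLaw_forall_mem r (isOpen_openCell M c).measurableSet.compl,
      compl_compl, measureReal_def]
  refine squeeze_zero (fun _ => measureReal_nonneg) hle ?_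
  have : ∀ c : Fin (k + 1) → Fin (M + 1), Tendsto (fun r : ℝ≥0 =>
      (poissonMeasure (r * (uniformCube (k + 1) (openCell M c)).toNNReal)).real {0}) atTop (𝓝 0) := by
    intro c
    refine (tendsto_poissonMeasure_real_singleton 0).comp ?_
    refine tendsto_id.atTop_mul_const ?_
    exact ENNReal.toNNReal_pos (uniformCube_openCell_pos M c).ne' (measure_ne_top _ _)
  simpa using tendsto_finsetSum Finset.univ fun c _ => this c

theorem samplePoints_eq_image {k : ℕ} [DecidableEq (EuclideanSpace ℝ (Fin (k + 1)))]
    {p : PoissonSample k} (hp : ∀ j, samplePoint p j ∈ openCube (k + 1)) :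
    samplePoints p = (Finset.range p.1.1).image (samplePoint p) := by
  ext x
  simp only [samplePoints, Finset.mem_filter, Finset.mem_image, Finset.mem_range]
  constructor
  · exact fun h => h.1
  · rintro ⟨j, hj, rfl⟩
    exact ⟨⟨j, hj, rfl⟩, hp j⟩

theorem abs_southLongestEdge_sub_ongLongestEdge_le {k M : ℕ} {p : PoissonSample k}
    (hp : ∀ j, samplePoint p j ∈ openCube (k + 1)) {σ : ℕ → ℕ}
    (hσ : (Finset.range p.1.1).image σ = Finset.range p.1.1)
    (hmono : StrictMonoOn (p.1.2 ∘ σ) (Set.Iio p.1.1)) (hM : p ∉ someCellEmpty k M) :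
    |southLongestEdge (samplePoints p) - ongLongestEdge (fun j => p.2 (σ j)) p.1.1| ≤
      ((k + 1 : ℕ) : ℝ) * (2 / ((M : ℝ) + 1)) := by
  classical
  set n := p.1.1
  set Z : ℕ → EuclideanSpace ℝ (Fin (k + 1)) := fun j => samplePoint p (σ j) with hZ
  have himg : samplePoints p = (Finset.range n).image Z := by
    rw [samplePoints_eq_image hp]
    conv_lhs => rw [← hσ]
    rw [Finset.image_image]
    rfl
  have hlast : ∀ j, Z j (Fin.last k) = p.1.2 (σ j) := fun j => by simp [hZ, samplePoint]
  have hsm : StrictMonoOn (fun i => Z i (Fin.last k)) (Set.Iio n) := by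
    simp only [hlast]
    exact hmono
  have hpos : (0 : ℝ) < (M : ℝ) + 1 := by positivity
  have hcell : ∀ c : Fin (k + 1) → Fin (M + 1), ∃ j < n, Z j ∈ openCell M c := by
    intro c
    simp only [someCellEmpty, Set.mem_iUnion, Set.mem_ofPred_eq, not_exists, not_forall,
      Set.mem_compl_iff, not_not] at hM
    obtain ⟨j, hj, hjc⟩ := hM c
    obtain ⟨i, hi, rfl⟩ := Finset.mem_image.1 (hσ.symm ▸ Finset.mem_range.2 hj)
    exact ⟨i, Finset.mem_range.1 hi, hjc⟩
  have h1 : ongLongestEdge (fun j => p.2 (σ j)) n ≤ southLongestEdge (samplePoints p) := by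
    rw [himg]
    exact ongLongestEdge_le_southLongestEdge Z _
      (fun i j => norm_fst_sub_le_norm_appendLast_sub (p.2 (σ i), p.1.2 (σ i))
        (p.2 (σ j), p.1.2 (σ j))) hsm
  have h2 : southLongestEdge (samplePoints p) ≤ ongLongestEdge (fun j => p.2 (σ j)) n +
      ((k + 1 : ℕ) : ℝ) * (2 / ((M : ℝ) + 1)) := by
    rw [himg]
    -- The threshold δ = 1/(M+1) is the thickness of the lowest layer of cells, the only one with no
    -- cell beneath it.
    refine southLongestEdge_le_ongLongestEdge_add Z _ (fun i j => ?_) hsm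
      (δ := 1 / ((M : ℝ) + 1)) ?_ (fun i _ => (hp (σ i) _).1.le) (by positivity)
      fun i _ hi => exists_lower_near_of_cells (fun j => hp (σ j)) hcell i hi
    · rw [hlast, hlast]
      exact norm_appendLast_sub_le (p.2 (σ i), p.1.2 (σ i)) (p.2 (σ j), p.1.2 (σ j))
    · rw [mul_div_assoc', div_le_div_iff_of_pos_right hpos]
      push_cast
      nlinarith [(Nat.cast_nonneg k : (0 : ℝ) ≤ k)]
  rw [abs_le]
  constructor <;> linarith

/-- An injective reindexing of an i.i.d. sequence has the same law; with the heights fixed, sorting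
by height is such a reindexing. -/
theorem integral_uniformSeq_comp {k : ℕ} {σ : ℕ → ℕ} (hσ : Function.Injective σ) (n : ℕ)
    {f : ℝ → ℝ} (hf : Continuous f) :
    ∫ y, f (ongLongestEdge (fun j => y (σ j)) n) ∂uniformSeq k =
      ∫ y, f (ongLongestEdge y n) ∂uniformSeq k := by
  have h := Measure.map_infinitePi_infinitePi_of_inj (P := fun _ : ℕ => uniformCube k) hσ
  change (uniformSeq k).map _ = uniformSeq k at h
  have hm : Measurable fun (y : ℕ → EuclideanSpace ℝ (Fin k)) (i : ℕ) => y (σ i) := by fun_prop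
  conv_rhs => rw [← h]
  exact (integral_map hm.aemeasurable
    (hf.measurable.comp (measurable_ongLongestEdge n)).aestronglyMeasurable).symm

variable {k : ℕ} {f : ℝ → ℝ} {C K : ℝ}

/-- Conditional comparison, for given heights, of the South tree with the on-line graph. -/
theorem abs_integral_southLongestEdge_sub_le (hf : Continuous f) (hC : ∀ x, |f x| ≤ C)
    (hK : ∀ x y, |f x - f y| ≤ K * |x - y|) (hK0 : 0 ≤ K) (M n : ℕ) {T : ℕ → ℝ}
    (hT : Function.Injective T) (hT' : ∀ i, T i ∈ Set.Ioo (0 : ℝ) 1) :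
    |∫ y, f (southLongestEdge (samplePoints ((n, T), y))) ∂uniformSeq k -
      ∫ y, f (ongLongestEdge y n) ∂uniformSeq k| ≤
    K * (((k + 1 : ℕ) : ℝ) * (2 / ((M : ℝ) + 1))) +
      ∫ y, (someCellEmpty k M).indicator (fun _ => 2 * C) ((n, T), y) ∂uniformSeq k := by
  -- With T fixed, σ is a constant, so no measurable choice of the sorting is needed.
  obtain ⟨σ, hinj, himg, hmono⟩ := exists_sorting T hT n
  have hC0 : 0 ≤ C := (abs_nonneg _).trans (hC 0)
  have hmk : Measurable fun y : ℕ → EuclideanSpace ℝ (Fin k) => (((n, T), y) : PoissonSample k) :=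
    measurable_prodMk_left
  have hm1 := hf.measurable.comp ((measurable_southLongestEdge_samplePoints k).comp hmk)
  have hmσ : Measurable fun (y : ℕ → EuclideanSpace ℝ (Fin k)) (i : ℕ) => y (σ i) := by fun_prop
  have hm2 := hf.measurable.comp ((measurable_ongLongestEdge n).comp hmσ)
  have hi1 : Integrable (fun y => f (southLongestEdge (samplePoints ((n, T), y)))) (uniformSeq k) :=
    (integrable_const C).mono' hm1.aestronglyMeasurable (Eventually.of_forall fun _ => hC _)
  have hi2 : Integrable (fun y => f (ongLongestEdge (fun j => y (σ j)) n)) (uniformSeq k) :=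
    (integrable_const C).mono' hm2.aestronglyMeasurable (Eventually.of_forall fun _ => hC _)
  have hi3 : Integrable (fun y => (someCellEmpty k M).indicator (fun _ => 2 * C)
      (((n, T), y) : PoissonSample k)) (uniformSeq k) := by
    refine (integrable_const (2 * C)).mono' ((measurable_const.indicator
      (measurableSet_someCellEmpty k M)).comp hmk).aestronglyMeasurable
      (Eventually.of_forall fun y => ?_)
    rw [Real.norm_eq_abs, abs_of_nonneg (Set.indicator_nonneg (fun _ _ => by positivity) _)]
    exact Set.indicator_le_self' (fun _ _ => by positivity) _
  rw [← integral_uniformSeq_comp hinj n hf, ← integral_sub hi1 hi2]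
  have hc : K * (((k + 1 : ℕ) : ℝ) * (2 / ((M : ℝ) + 1))) =
      ∫ _y, K * (((k + 1 : ℕ) : ℝ) * (2 / ((M : ℝ) + 1))) ∂uniformSeq k := by simp
  rw [hc, ← integral_add (integrable_const _) hi3]
  rw [← Real.norm_eq_abs]
  refine norm_integral_le_of_norm_le ((integrable_const _).add hi3) ?_
  filter_upwards [ae_uniformSeq_mem_openCube k] with y hy
  -- If some cell is empty, the difference is bounded by 2C; otherwise the Lipschitz bound applies
  -- to the deterministic comparison.
  by_cases hM : (((n, T), y) : PoissonSample k) ∈ someCellEmpty k M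
  · rw [Set.indicator_of_mem hM, Real.norm_eq_abs]
    have h1 := abs_sub (f (southLongestEdge (samplePoints ((n, T), y))))
      (f (ongLongestEdge (fun j => y (σ j)) n))
    have h2 : 0 ≤ K * (((k + 1 : ℕ) : ℝ) * (2 / ((M : ℝ) + 1))) := by positivity
    linarith [hC (southLongestEdge (samplePoints ((n, T), y))),
      hC (ongLongestEdge (fun j => y (σ j)) n)]
  · rw [Set.indicator_of_notMem hM, add_zero, Real.norm_eq_abs]
    refine (hK _ _).trans (mul_le_mul_of_nonneg_left ?_ hK0)
    exact abs_southLongestEdge_sub_ongLongestEdge_le (p := ((n, T), y))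
      (fun j => (appendLast_mem_openCube_iff _).2 ⟨hy j, hT' j⟩) himg hmono hM

instance nullSingletonClass_uniform01 : NullSingletonClass uniform01 := by
  unfold uniform01; infer_instance

/-- The conditional comparison integrated over number and heights. Each term is first written as an
integral over that pair, so that the bound can be applied pointwise. -/
theorem abs_integral_southLaw_sub_le (hf : Continuous f) (hC : ∀ x, |f x| ≤ C)
    (hK : ∀ x y, |f x - f y| ≤ K * |x - y|) (hK0 : 0 ≤ K) (M : ℕ) (r : ℝ≥0) :
    |∫ x, f x ∂(southLaw k r : Measure ℝ) - ∫ x, f x ∂(ongPoissonLaw k r : Measure ℝ)| ≤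
      K * (((k + 1 : ℕ) : ℝ) * (2 / ((M : ℝ) + 1))) +
        2 * C * (poissonSampleLaw k r).real (someCellEmpty k M) := by
  have hmL := measurable_southLongestEdge_samplePoints k
  have hi1 : Integrable (fun p : PoissonSample k => f (southLongestEdge (samplePoints p)))
      (poissonSampleLaw k r) :=
    (integrable_const C).mono' (hf.measurable.comp hmL).aestronglyMeasurable
      (Eventually.of_forall fun _ => hC _)
  have hi2 : Integrable (fun q : ℕ × (ℕ → ℝ) => ∫ y, f (ongLongestEdge y q.1) ∂uniformSeq k)
      ((poissonMeasure r).prod (Measure.infinitePi fun _ : ℕ => uniform01)) :=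
    (integrable_const C).mono' (by
      have : Measurable fun n : ℕ => ∫ y, f (ongLongestEdge y n) ∂uniformSeq k := .of_discrete
      exact (this.comp measurable_fst).aestronglyMeasurable)
      (Eventually.of_forall fun q => abs_integral_le_of_forall_abs_le _ fun _ => hC _)
  have hi3 : Integrable ((someCellEmpty k M).indicator fun _ => 2 * C) (poissonSampleLaw k r) :=
    (integrable_const _).indicator (measurableSet_someCellEmpty k M)
  have e1 : ∫ x, f x ∂(southLaw k r : Measure ℝ) =
      ∫ q, ∫ y, f (southLongestEdge (samplePoints (q, y))) ∂uniformSeq k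
        ∂((poissonMeasure r).prod (Measure.infinitePi fun _ : ℕ => uniform01)) := by
    rw [southLaw, ProbabilityMeasure.coe_mk, integral_map hmL.aemeasurable hf.aestronglyMeasurable]
    exact integral_prod _ hi1
  have e2 : ∫ x, f x ∂(ongPoissonLaw k r : Measure ℝ) =
      ∫ q, ∫ y, f (ongLongestEdge y q.1) ∂uniformSeq k
        ∂((poissonMeasure r).prod (Measure.infinitePi fun _ : ℕ => uniform01)) := by
    rw [integral_ongPoissonLaw k r hf hC, integral_prod _ hi2]
    simp
  have e3 : 2 * C * (poissonSampleLaw k r).real (someCellEmpty k M) =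
      ∫ q, ∫ y, (someCellEmpty k M).indicator (fun _ => 2 * C) (q, y) ∂uniformSeq k
        ∂((poissonMeasure r).prod (Measure.infinitePi fun _ : ℕ => uniform01)) := by
    rw [← integral_prod _ hi3]
    change _ = ∫ p, _ ∂poissonSampleLaw k r
    rw [integral_indicator_const _ (measurableSet_someCellEmpty k M), smul_eq_mul, mul_comm]
  have e4 : K * (((k + 1 : ℕ) : ℝ) * (2 / ((M : ℝ) + 1))) =
      ∫ _q, K * (((k + 1 : ℕ) : ℝ) * (2 / ((M : ℝ) + 1)))
        ∂((poissonMeasure r).prod (Measure.infinitePi fun _ : ℕ => uniform01)) := by simp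
  rw [e1, e2, e3, e4, ← integral_sub hi1.integral_prod_left hi2,
    ← integral_add (integrable_const _) hi3.integral_prod_left]
  rw [← Real.norm_eq_abs]
  refine norm_integral_le_of_norm_le ((integrable_const _).add hi3.integral_prod_left) ?_
  have hT : ∀ᵐ q : ℕ × (ℕ → ℝ) ∂(poissonMeasure r).prod (Measure.infinitePi fun _ => uniform01),
      Function.Injective q.2 ∧ ∀ i, q.2 i ∈ Set.Ioo (0 : ℝ) 1 :=
    Measure.quasiMeasurePreserving_snd.ae ((ae_injective_infinitePi uniform01).and
      (ae_forall_infinitePi uniform01 (ae_restrict_mem measurableSet_Ioo)))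
  filter_upwards [hT] with q hq
  exact abs_integral_southLongestEdge_sub_le hf hC hK hK0 M q.1 hq.1 hq.2

theorem tendsto_integral_southLaw (hf : Continuous f) (hC : ∀ x, |f x| ≤ C)
    (hK : ∀ x y, |f x - f y| ≤ K * |x - y|) (hK0 : 0 ≤ K) :
    Tendsto (fun r => ∫ x, f x ∂(southLaw k r : Measure ℝ)) atTop
      (𝓝 (∫ x, f x ∂(ongSupLaw k : Measure ℝ))) := by
  have hdiff : Tendsto (fun r => ∫ x, f x ∂(southLaw k r : Measure ℝ) -
      ∫ x, f x ∂(ongPoissonLaw k r : Measure ℝ)) atTop (𝓝 0) := by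
    rw [tendsto_zero_iff_norm_tendsto_zero, tendsto_order]
    refine ⟨fun b hb => Eventually.of_forall fun r => hb.trans_le (norm_nonneg _), fun ε hε => ?_⟩
    have hlim : Tendsto (fun M : ℕ => K * (((k + 1 : ℕ) : ℝ) * (2 / ((M : ℝ) + 1)))) atTop
        (𝓝 0) := by
      have := (((tendsto_one_div_add_atTop_nhds_zero_nat (𝕜 := ℝ)).const_mul 2).const_mul
        ((k + 1 : ℕ) : ℝ)).const_mul K
      simpa [div_eq_mul_inv] using this
    -- The mesh is fixed first to control the Lipschitz term; only then does r grow, to make empty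
    -- cells improbable.
    obtain ⟨M, hM⟩ := (hlim.eventually_lt_const (half_pos hε)).exists
    have h2 : Tendsto (fun r => 2 * C * (poissonSampleLaw k r).real (someCellEmpty k M)) atTop
        (𝓝 0) := by
      simpa using (tendsto_poissonSampleLaw_someCellEmpty k M).const_mul (2 * C)
    filter_upwards [h2.eventually_lt_const (half_pos hε)] with r hr
    exact (abs_integral_southLaw_sub_le hf hC hK hK0 M r).trans_lt (by linarith)
  simpa using hdiff.add (tendsto_integral_ongPoissonLaw k hf hC)

theorem tendsto_southLaw (k : ℕ) : Tendsto (southLaw k) atTop (𝓝 (ongSupLaw k)) := by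
  rw [tendsto_iff_forall_lipschitz_integral_tendsto]
  rintro f ⟨C, hC⟩ ⟨L, hL⟩
  -- Boundedness of f is given as a bound C on its oscillation, hence the supremum bound |f 0| + C.
  refine tendsto_integral_southLaw (C := |f 0| + C) (K := L) hL.continuous (fun x => ?_)
    (fun x y => ?_) L.2
  · have h1 := hC x 0
    rw [Real.dist_eq] at h1
    have h2 := abs_add_le (f x - f 0) (f 0)
    rw [sub_add_cancel] at h2
    linarith
  · simpa [Real.dist_eq] using hL.dist_le_mul x y

theorem tendstoInDistribution_southLongestEdge {ι : Type*} (l : Filter ι)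
    (r : ι → ℝ≥0) (hr : Tendsto r l atTop) {Ω : ι → Type*} [∀ i, MeasurableSpace (Ω i)]
    (μ : ∀ i, Measure (Ω i)) [∀ i, IsProbabilityMeasure (μ i)]
    (P : ∀ i, Ω i → Finset (EuclideanSpace ℝ (Fin (k + 1))))
    (hP : ∀ i, IsPoissonProcess (r i) (P i) (μ i)) :
    TendstoInDistribution (fun i ω => southLongestEdge (P i ω)) l
      (fun q : ℝ => q) μ (ongSupLaw k : Measure ℝ) :=
  tendstoInDistribution_of_map_eq (fun i => (measurable_southLongestEdge (hP i).subset_cube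
    fun _ => (hP i).measurableSet_avoid).aemeasurable) (tendsto_southLaw k) hr
    fun i => (hP i).map_southLongestEdge

end Comparison


/-! ### Existence and uniqueness of the max-Dickman law -/

section MaxDickman

/-- The map whose fixed laws are the max-Dickman distributions. -/
noncomputable def dickmanStep (p : ℝ × ℝ) : ℝ := max (1 - p.1) (p.1 * p.2)

theorem measurable_dickmanStep : Measurable dickmanStep := by
  unfold dickmanStep; fun_prop

/-- The `n`-fold iterate of the max-Dickman recursion, driven by the sequence `u` and started
from `m`. -/
noncomputable def dickmanIter : ℕ → ℝ → (ℕ → ℝ) → ℝ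
  | 0, m, _ => m
  | n + 1, m, u => dickmanStep (u 0, dickmanIter n m fun i => u (i + 1))

theorem measurable_dickmanIter (n : ℕ) :
    Measurable fun p : ℝ × (ℕ → ℝ) => dickmanIter n p.1 p.2 := by
  induction n with
  | zero => exact measurable_fst
  | succ n ih =>
    have h : Measurable fun p : ℝ × (ℕ → ℝ) => (p.1, fun i => p.2 (i + 1)) := by fun_prop
    have h0 : Measurable fun p : ℝ × (ℕ → ℝ) => p.2 0 := by fun_prop
    exact measurable_dickmanStep.comp (h0.prodMk (ih.comp h))

theorem abs_dickmanStep_sub_le {u : ℝ} (hu : 0 ≤ u) (m m' : ℝ) :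
    |dickmanStep (u, m) - dickmanStep (u, m')| ≤ u * |m - m'| := by
  refine (abs_max_sub_max_le_max _ _ _ _).trans ?_
  simp only [sub_self, abs_zero]
  rw [← mul_sub, abs_mul, abs_of_nonneg hu]
  exact max_le (by positivity) le_rfl

/-- Each step contracts by its uniform variable, so the dependence on the starting value decays like
the product. -/
theorem abs_dickmanIter_sub_le (n : ℕ) (m m' : ℝ) {u : ℕ → ℝ}
    (hu : ∀ i, u i ∈ Set.Ioo (0 : ℝ) 1) :
    |dickmanIter n m u - dickmanIter n m' u| ≤ (∏ i ∈ Finset.range n, u i) * |m - m'| := by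
  induction n generalizing u with
  | zero => simp [dickmanIter]
  | succ n ih =>
    refine (abs_dickmanStep_sub_le (hu 0).1.le _ _).trans ?_
    rw [Finset.prod_range_succ', mul_comm _ (u 0), mul_assoc]
    exact mul_le_mul_of_nonneg_left (ih fun i => hu (i + 1)) (hu 0).1.le

theorem dickmanStep_mono {u m m' : ℝ} (hu : 0 ≤ u) (h : m ≤ m') :
    dickmanStep (u, m) ≤ dickmanStep (u, m') :=
  max_le_max le_rfl (mul_le_mul_of_nonneg_left h hu)

theorem dickmanIter_mem_Icc (n : ℕ) {u : ℕ → ℝ} (hu : ∀ i, u i ∈ Set.Ioo (0 : ℝ) 1) :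
    dickmanIter n 0 u ∈ Set.Icc (0 : ℝ) 1 := by
  induction n generalizing u with
  | zero => simp [dickmanIter]
  | succ n ih =>
    have h := ih fun i => hu (i + 1)
    have h0 := hu 0
    refine ⟨le_max_of_le_left (by linarith [h0.2]), max_le (by linarith [h0.1]) ?_⟩
    exact mul_le_one₀ h0.2.le h.1 h.2

/-- The new variable enters innermost: it replaces the start 0 by a nonnegative value, and the outer
steps are monotone. -/
theorem monotone_dickmanIter {u : ℕ → ℝ} (hu : ∀ i, u i ∈ Set.Ioo (0 : ℝ) 1) :
    Monotone fun n => dickmanIter n 0 u := by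
  refine monotone_nat_of_le_succ fun n => ?_
  induction n generalizing u with
  | zero => exact (dickmanIter_mem_Icc 1 hu).1
  | succ n ih => exact dickmanStep_mono (hu 0).1.le (ih fun i => hu (i + 1))

/-- The limit of the iterates of the max-Dickman recursion. -/
noncomputable def dickmanLim (u : ℕ → ℝ) : ℝ := ⨆ n, dickmanIter n 0 u

theorem measurable_dickmanLim : Measurable dickmanLim :=
  Measurable.iSup fun n => (measurable_dickmanIter n).comp measurable_prodMk_left

theorem tendsto_dickmanIter_zero {u : ℕ → ℝ} (hu : ∀ i, u i ∈ Set.Ioo (0 : ℝ) 1) :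
    Tendsto (fun n => dickmanIter n 0 u) atTop (𝓝 (dickmanLim u)) :=
  tendsto_atTop_ciSup (monotone_dickmanIter hu)
    ⟨1, by rintro _ ⟨n, rfl⟩; exact (dickmanIter_mem_Icc n hu).2⟩

theorem dickmanLim_seqCons {u : ℝ} {v : ℕ → ℝ} (hu : u ∈ Set.Ioo (0 : ℝ) 1)
    (hv : ∀ i, v i ∈ Set.Ioo (0 : ℝ) 1) :
    dickmanLim (seqCons (u, v)) = dickmanStep (u, dickmanLim v) := by
  have h1 : ∀ i, seqCons (u, v) i ∈ Set.Ioo (0 : ℝ) 1 := by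
    intro i
    cases i with
    | zero => exact hu
    | succ i => exact hv i
  have h2 := (tendsto_dickmanIter_zero h1).comp (tendsto_add_atTop_nat 1)
  have hc : Continuous fun m => dickmanStep (u, m) := by unfold dickmanStep; fun_prop
  exact tendsto_nhds_unique h2 ((hc.tendsto _).comp (tendsto_dickmanIter_zero hv))

theorem ae_uniform01_mem : ∀ᵐ u ∂uniform01, u ∈ Set.Ioo (0 : ℝ) 1 :=
  ae_restrict_mem measurableSet_Ioo

theorem ae_infinitePi_uniform01_mem :
    ∀ᵐ u ∂Measure.infinitePi (fun _ : ℕ => uniform01), ∀ i, u i ∈ Set.Ioo (0 : ℝ) 1 :=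
  ae_forall_infinitePi _ ae_uniform01_mem

theorem integral_uniform01 (g : ℝ → ℝ) : ∫ u, g u ∂uniform01 = ∫ u in (0 : ℝ)..1, g u := by
  rw [uniform01, intervalIntegral.integral_of_le zero_le_one, integral_Ioc_eq_integral_Ioo]

theorem lintegral_ofReal_uniform01 :
    ∫⁻ u, ENNReal.ofReal u ∂uniform01 = ENNReal.ofReal (1 / 2) := by
  rw [← ofReal_integral_eq_lintegral_ofReal, integral_uniform01]
  · norm_num
  · refine (integrable_const (1 : ℝ)).mono' measurable_id.aestronglyMeasurable ?_
    filter_upwards [ae_uniform01_mem] with u hu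
    rw [Real.norm_eq_abs, abs_of_pos hu.1]
    exact hu.2.le
  · filter_upwards [ae_uniform01_mem] with u hu using hu.1.le

/-- The product of n uniforms has mean 2⁻ⁿ, which is summable; the series of products is therefore
almost surely finite and its terms tend to 0. -/
theorem ae_tendsto_prod_uniform01 :
    ∀ᵐ u ∂Measure.infinitePi (fun _ : ℕ => uniform01),
      Tendsto (fun n => ∏ i ∈ Finset.range n, u i) atTop (𝓝 0) := by
  have hmeas : ∀ n : ℕ, Measurable fun u : ℕ → ℝ => ∏ i ∈ Finset.range n, ENNReal.ofReal (u i) :=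
    fun n => Finset.measurable_fun_prod _ fun i _ => (measurable_pi_apply i).ennreal_ofReal
  have hind : iIndepFun (fun (j : ℕ) (u : ℕ → ℝ) => ENNReal.ofReal (u j))
      (Measure.infinitePi fun _ : ℕ => uniform01) :=
    iIndepFun_infinitePi (P := fun _ : ℕ => uniform01)
      (X := fun (_ : ℕ) t => ENNReal.ofReal t) fun _ => ENNReal.measurable_ofReal
  have h1 : ∀ n : ℕ, ∫⁻ u : ℕ → ℝ, ∏ i ∈ Finset.range n, ENNReal.ofReal (u i)
      ∂Measure.infinitePi (fun _ : ℕ => uniform01) = ENNReal.ofReal (1 / 2) ^ n := by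
    intro n
    rw [lintegral_prod_eq_prod_lintegral_of_indepFun (Finset.range n) _ hind
      fun j => (measurable_pi_apply j).ennreal_ofReal]
    have h2 : ∀ j : ℕ, ∫⁻ u : ℕ → ℝ, ENNReal.ofReal (u j)
        ∂Measure.infinitePi (fun _ : ℕ => uniform01) = ENNReal.ofReal (1 / 2) := fun j => by
      rw [← lintegral_ofReal_uniform01]
      exact (measurePreserving_eval_infinitePi (fun _ : ℕ => uniform01) j).lintegral_comp
        ENNReal.measurable_ofReal
    simp [h2]
  have hsum : ∫⁻ u : ℕ → ℝ, ∑' n, ∏ i ∈ Finset.range n, ENNReal.ofReal (u i)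
      ∂Measure.infinitePi (fun _ : ℕ => uniform01) ≠ ∞ := by
    rw [lintegral_tsum fun n => (hmeas n).aemeasurable]
    simp only [h1]
    rw [ENNReal.tsum_geometric, ENNReal.inv_ne_top]
    refine (tsub_pos_of_lt ?_).ne'
    rw [← ENNReal.ofReal_one]
    exact (ENNReal.ofReal_lt_ofReal_iff one_pos).2 (by norm_num)
  filter_upwards [ae_lt_top (Measurable.tsum hmeas) hsum, ae_infinitePi_uniform01_mem]
    with u hu hu01
  have h3 := ENNReal.tendsto_atTop_zero_of_tsum_ne_top hu.ne
  have h4 := (ENNReal.tendsto_toReal ENNReal.zero_ne_top).comp h3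
  refine h4.congr fun n => ?_
  simp only [Function.comp_apply, ENNReal.toReal_prod]
  exact Finset.prod_congr rfl fun i _ => ENNReal.toReal_ofReal (hu01 i).1.le

variable {D : ProbabilityMeasure ℝ}

theorem IsMaxDickman.measurePreserving_dickmanStep (hD : IsMaxDickman D) :
    MeasurePreserving dickmanStep (uniform01.prod (D : Measure ℝ)) (D : Measure ℝ) :=
  ⟨measurable_dickmanStep, hD⟩

theorem IsMaxDickman.measurePreserving_dickmanIter (hD : IsMaxDickman D) (n : ℕ) :
    MeasurePreserving (fun p : ℝ × (ℕ → ℝ) => dickmanIter n p.1 p.2)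
      ((D : Measure ℝ).prod (Measure.infinitePi fun _ : ℕ => uniform01)) (D : Measure ℝ) := by
  induction n with
  | zero => exact measurePreserving_fst
  | succ n ih =>
    refine ⟨measurable_dickmanIter (n + 1), ?_⟩
    -- Reorders (u₀, m, later uniforms) into a start and a full driving sequence, so that n + 1
    -- iterations become one step applied to n iterations.
    have hF : MeasurePreserving (fun q : ℝ × ℝ × (ℕ → ℝ) => (q.2.1, seqCons (q.1, q.2.2)))
        (uniform01.prod ((D : Measure ℝ).prod (Measure.infinitePi fun _ : ℕ => uniform01)))
        ((D : Measure ℝ).prod (Measure.infinitePi fun _ : ℕ => uniform01)) := by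
      have h1 := (measurePreserving_prodAssoc uniform01 (D : Measure ℝ)
        (Measure.infinitePi fun _ : ℕ => uniform01)).symm
      have h2 := (Measure.measurePreserving_swap (μ := uniform01) (ν := (D : Measure ℝ))).prod
        (MeasurePreserving.id (Measure.infinitePi fun _ : ℕ => uniform01))
      have h3 := measurePreserving_prodAssoc (D : Measure ℝ) uniform01
        (Measure.infinitePi fun _ : ℕ => uniform01)
      have h4 := (MeasurePreserving.id (D : Measure ℝ)).prod (measurePreserving_seqCons uniform01)
      exact h4.comp (h3.comp (h2.comp h1))
    have hG := hD.measurePreserving_dickmanStep.comp ((MeasurePreserving.id uniform01).prod ih)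
    rw [← hF.map_eq, Measure.map_map (measurable_dickmanIter (n + 1)) hF.measurable]
    exact hG.map_eq

/-- The law of the limit of the max-Dickman recursion. -/
noncomputable def dickmanLaw : ProbabilityMeasure ℝ :=
  ⟨(Measure.infinitePi fun _ : ℕ => uniform01).map dickmanLim,
    Measure.isProbabilityMeasure_map measurable_dickmanLim.aemeasurable⟩

/-- The fixed-point identity holds pathwise: prepending a uniform variable applies one step to the
limit. -/
theorem isMaxDickman_dickmanLaw : IsMaxDickman dickmanLaw := by
  have hmp : MeasurePreserving dickmanLim (Measure.infinitePi fun _ : ℕ => uniform01)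
      (dickmanLaw : Measure ℝ) := ⟨measurable_dickmanLim, rfl⟩
  have h1 := (MeasurePreserving.id uniform01).prod hmp
  have h2 : MeasurePreserving (dickmanLim ∘ seqCons)
      (uniform01.prod (Measure.infinitePi fun _ : ℕ => uniform01)) (dickmanLaw : Measure ℝ) :=
    hmp.comp (measurePreserving_seqCons uniform01)
  change (uniform01.prod (dickmanLaw : Measure ℝ)).map dickmanStep = _
  rw [← h1.map_eq, Measure.map_map measurable_dickmanStep h1.measurable, ← h2.map_eq]
  refine Measure.map_congr ?_
  filter_upwards [Measure.quasiMeasurePreserving_fst.ae ae_uniform01_mem,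
    Measure.quasiMeasurePreserving_snd.ae ae_infinitePi_uniform01_mem] with p hp1 hp2
  exact (dickmanLim_seqCons hp1 hp2).symm

/-- Started from law D, every iterate has law D, yet the iterates converge almost surely to
`dickmanLim`, whatever the start. -/
theorem IsMaxDickman.eq_dickmanLaw (hD : IsMaxDickman D) : D = dickmanLaw := by
  suffices h : (D : Measure ℝ) = (dickmanLaw : Measure ℝ) from Subtype.ext h
  refine ext_of_forall_integral_eq_of_IsFiniteMeasure fun f => ?_
  have h1 : ∀ n : ℕ, ∫ p : ℝ × (ℕ → ℝ), f (dickmanIter n p.1 p.2)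
      ∂(D : Measure ℝ).prod (Measure.infinitePi fun _ : ℕ => uniform01) =
      ∫ x, f x ∂(D : Measure ℝ) := by
    intro n
    have h := hD.measurePreserving_dickmanIter n
    conv_rhs => rw [← h.map_eq]
    exact (integral_map h.measurable.aemeasurable f.continuous.aestronglyMeasurable).symm
  have hae : ∀ᵐ p : ℝ × (ℕ → ℝ) ∂(D : Measure ℝ).prod (Measure.infinitePi fun _ => uniform01),
      Tendsto (fun n => dickmanIter n p.1 p.2) atTop (𝓝 (dickmanLim p.2)) := by
    filter_upwards [Measure.quasiMeasurePreserving_snd.ae ae_tendsto_prod_uniform01,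
      Measure.quasiMeasurePreserving_snd.ae ae_infinitePi_uniform01_mem] with p h0 hu
    have h1 : Tendsto (fun n => dickmanIter n p.1 p.2 - dickmanIter n 0 p.2) atTop (𝓝 0) := by
      rw [tendsto_zero_iff_norm_tendsto_zero]
      refine squeeze_zero (fun _ => norm_nonneg _) (fun n => abs_dickmanIter_sub_le n p.1 0 hu) ?_
      simpa using h0.mul_const |p.1 - 0|
    simpa using h1.add (tendsto_dickmanIter_zero hu)
  have h2 : Tendsto (fun n : ℕ => ∫ p : ℝ × (ℕ → ℝ), f (dickmanIter n p.1 p.2)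
      ∂(D : Measure ℝ).prod (Measure.infinitePi fun _ : ℕ => uniform01)) atTop
      (𝓝 (∫ p : ℝ × (ℕ → ℝ), f (dickmanLim p.2)
        ∂(D : Measure ℝ).prod (Measure.infinitePi fun _ : ℕ => uniform01))) := by
    refine tendsto_integral_of_dominated_convergence (fun _ => ‖f‖)
      (fun n => (f.continuous.measurable.comp (measurable_dickmanIter n)).aestronglyMeasurable)
      (integrable_const _) (fun n => Eventually.of_forall fun p => f.norm_coe_le_norm _) ?_
    filter_upwards [hae] with p hp
    exact (f.continuous.tendsto _).comp hp
  simp only [h1] at h2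
  rw [tendsto_nhds_unique tendsto_const_nhds h2, dickmanLaw, ProbabilityMeasure.coe_mk,
    integral_map measurable_dickmanLim.aemeasurable f.continuous.aestronglyMeasurable]
  simpa using integral_fun_snd (μ := (D : Measure ℝ))
    (ν := Measure.infinitePi fun _ : ℕ => uniform01) (fun u => f (dickmanLim u))

theorem existsUnique_isMaxDickman : ∃! D : ProbabilityMeasure ℝ, IsMaxDickman D :=
  ⟨dickmanLaw, isMaxDickman_dickmanLaw, fun _ hD => hD.eq_dickmanLaw⟩

end MaxDickman


/-! ### Records of a sequence on the line -/

section Records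

/-- The running minimum of a sequence of points of the line. -/
noncomputable def runMin (y : ℕ → EuclideanSpace ℝ (Fin 1)) : ℕ → ℝ
  | 0 => y 0 0
  | n + 1 => min (runMin y n) (y (n + 1) 0)

/-- The running maximum of a sequence of points of the line. -/
noncomputable def runMax (y : ℕ → EuclideanSpace ℝ (Fin 1)) : ℕ → ℝ
  | 0 => y 0 0
  | n + 1 => max (runMax y n) (y (n + 1) 0)

theorem norm_eq_abs_apply_zero (x : EuclideanSpace ℝ (Fin 1)) : ‖x‖ = |x 0| := by
  simp [EuclideanSpace.norm_eq, Real.sqrt_sq_eq_abs]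

variable (y : ℕ → EuclideanSpace ℝ (Fin 1))

theorem runMin_le (n : ℕ) : ∀ j ≤ n, runMin y n ≤ y j 0 := by
  induction n with
  | zero =>
    intro j hj
    obtain rfl : j = 0 := by omega
    exact le_rfl
  | succ n ih =>
    intro j hj
    rcases Nat.lt_or_ge n j with h | h
    · obtain rfl : j = n + 1 := by omega
      exact min_le_right _ _
    · exact (min_le_left _ _).trans (ih j h)

theorem le_runMax (n : ℕ) : ∀ j ≤ n, y j 0 ≤ runMax y n := by
  induction n with
  | zero =>
    intro j hj
    obtain rfl : j = 0 := by omega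
    exact le_rfl
  | succ n ih =>
    intro j hj
    rcases Nat.lt_or_ge n j with h | h
    · obtain rfl : j = n + 1 := by omega
      exact le_max_right _ _
    · exact (ih j h).trans (le_max_left _ _)

theorem exists_eq_runMin (n : ℕ) : ∃ j ≤ n, y j 0 = runMin y n := by
  induction n with
  | zero => exact ⟨0, le_rfl, rfl⟩
  | succ n ih =>
    rcases le_total (runMin y n) (y (n + 1) 0) with h | h
    · obtain ⟨j, hj, hj'⟩ := ih
      exact ⟨j, hj.trans n.le_succ, hj'.trans (min_eq_left h).symm⟩
    · exact ⟨n + 1, le_rfl, (min_eq_right h).symm⟩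

theorem exists_eq_runMax (n : ℕ) : ∃ j ≤ n, y j 0 = runMax y n := by
  induction n with
  | zero => exact ⟨0, le_rfl, rfl⟩
  | succ n ih =>
    rcases le_total (y (n + 1) 0) (runMax y n) with h | h
    · obtain ⟨j, hj, hj'⟩ := ih
      exact ⟨j, hj.trans n.le_succ, hj'.trans (max_eq_left h).symm⟩
    · exact ⟨n + 1, le_rfl, (max_eq_right h).symm⟩

theorem runMin_le_runMax (n : ℕ) : runMin y n ≤ runMax y n :=
  (runMin_le y n 0 n.zero_le).trans (le_runMax y n 0 n.zero_le)

theorem ongDist_succ_le_iff (n : ℕ) {t : ℝ} (ht : 0 ≤ t) :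
    ongDist y (n + 1) ≤ t ↔ ∃ j ≤ n, |y (n + 1) 0 - y j 0| ≤ t := by
  rw [ongDist_le_iff y _ ht]
  simp only [Nat.lt_succ_iff, Nat.zero_le, true_imp_iff, norm_eq_abs_apply_zero, PiLp.sub_apply]

theorem gap_le_of_ongDist_le {n : ℕ} {t : ℝ} (ht : 0 ≤ t) (h : ongDist y (n + 1) ≤ t) :
    runMin y n - y (n + 1) 0 ≤ t ∧ y (n + 1) 0 - runMax y n ≤ t := by
  obtain ⟨j, hj, hjt⟩ := (ongDist_succ_le_iff y n ht).1 h
  have h1 := runMin_le y n j hj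
  have h2 := le_runMax y n j hj
  rw [abs_le] at hjt
  constructor <;> linarith

/-- Every location between the extreme points is within the longest edge length of some point. -/
theorem exists_abs_sub_le_ongLongestEdge (n : ℕ) {x : ℝ} (h1 : runMin y n ≤ x)
    (h2 : x ≤ runMax y n) : ∃ j ≤ n, |x - y j 0| ≤ ongLongestEdge y (n + 1) := by
  induction n with
  | zero =>
    refine ⟨0, le_rfl, ?_⟩
    have : x = y 0 0 := le_antisymm h2 h1
    rw [this, sub_self, abs_zero]
    exact ongLongestEdge_nonneg y 1
  | succ n ih =>
    have hgap := gap_le_of_ongDist_le y (n := n) (ongDist_nonneg y (n + 1)) le_rfl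
    have hle : ongDist y (n + 1) ≤ ongLongestEdge y (n + 1 + 1) := by
      rw [ongLongestEdge_succ y (n + 1)]; exact le_max_right _ _
    -- A location outside the old range lies between the new extreme point and the old one, and that
    -- gap is at most the length of the new edge.
    rcases lt_or_ge x (runMin y n) with h | h
    · have hx : y (n + 1) 0 ≤ x := by
        rcases min_le_iff.1 h1 with h' | h'
        · exact absurd h (not_lt.2 h')
        · exact h'
      refine ⟨n + 1, le_rfl, ?_⟩
      rw [abs_of_nonneg (by linarith)]
      linarith [hgap.1]
    · rcases lt_or_ge (runMax y n) x with h' | h'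
      · have hx : x ≤ y (n + 1) 0 := by
          rcases le_max_iff.1 h2 with h'' | h''
          · exact absurd h' (not_lt.2 h'')
          · exact h''
        refine ⟨n + 1, le_rfl, ?_⟩
        rw [abs_of_nonpos (by linarith)]
        linarith [hgap.2]
      · obtain ⟨j, hj, hj'⟩ := ih h h'
        exact ⟨j, hj.trans n.le_succ, hj'.trans (ongLongestEdge_mono y (Nat.le_succ _))⟩

/-- On the line, the longest edge grows only at records. -/
theorem ongLongestEdge_succ_succ_le_iff (n : ℕ) {t : ℝ} (ht : 0 ≤ t) :
    ongLongestEdge y (n + 2) ≤ t ↔ ongLongestEdge y (n + 1) ≤ t ∧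
      (runMin y n - y (n + 1) 0 ≤ t ∧ y (n + 1) 0 - runMax y n ≤ t) := by
  rw [ongLongestEdge_succ y (n + 1), max_le_iff]
  refine and_congr_right fun hO => ⟨gap_le_of_ongDist_le y ht, fun ⟨h1, h2⟩ => ?_⟩
  rw [ongDist_succ_le_iff y n ht]
  -- A new record is joined to the old extreme point. Any other arrival falls in the old range,
  -- where some earlier point is within the longest edge length so far.
  rcases lt_or_ge (y (n + 1) 0) (runMin y n) with h | h
  · obtain ⟨j, hj, hj'⟩ := exists_eq_runMin y n
    refine ⟨j, hj, ?_⟩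
    rw [hj', abs_of_neg (by linarith)]
    linarith
  · rcases lt_or_ge (runMax y n) (y (n + 1) 0) with h' | h'
    · obtain ⟨j, hj, hj'⟩ := exists_eq_runMax y n
      refine ⟨j, hj, ?_⟩
      rwa [hj', abs_of_pos (by linarith)]
    · obtain ⟨j, hj, hj'⟩ := exists_abs_sub_le_ongLongestEdge y n h h'
      exact ⟨j, hj, hj'.trans hO⟩

variable {y}

theorem runMin_congr {y y' : ℕ → EuclideanSpace ℝ (Fin 1)} {n : ℕ} (h : ∀ j ≤ n, y j = y' j) :
    runMin y n = runMin y' n := by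
  induction n with
  | zero => simp [runMin, h 0 le_rfl]
  | succ n ih =>
    simp only [runMin, h (n + 1) le_rfl, ih fun j hj => h j (hj.trans n.le_succ)]

theorem runMax_congr {y y' : ℕ → EuclideanSpace ℝ (Fin 1)} {n : ℕ} (h : ∀ j ≤ n, y j = y' j) :
    runMax y n = runMax y' n := by
  induction n with
  | zero => simp [runMax, h 0 le_rfl]
  | succ n ih =>
    simp only [runMax, h (n + 1) le_rfl, ih fun j hj => h j (hj.trans n.le_succ)]

theorem ongLongestEdge_congr {d : ℕ} {y y' : ℕ → EuclideanSpace ℝ (Fin d)} {n : ℕ}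
    (h : ∀ j < n, y j = y' j) : ongLongestEdge y n = ongLongestEdge y' n := by
  have key : ∀ {y y' : ℕ → EuclideanSpace ℝ (Fin d)}, (∀ j < n, y j = y' j) →
      ongLongestEdge y n ≤ ongLongestEdge y' n := by
    intro y y' h
    rw [ongLongestEdge_le_iff y n (ongLongestEdge_nonneg y' n)]
    intro i hi hi0
    obtain ⟨j, hj, hj'⟩ := (ongLongestEdge_le_iff y' n (ongLongestEdge_nonneg y' n)).1 le_rfl i hi hi0
    exact ⟨j, hj, by rwa [h i hi, h j (hj.trans hi)]⟩
  exact le_antisymm (key h) (key fun j hj => (h j hj).symm)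

theorem measurable_runMin (n : ℕ) : Measurable fun y => runMin y n := by
  induction n with
  | zero => unfold runMin; fun_prop
  | succ n ih =>
    have : Measurable fun y : ℕ → EuclideanSpace ℝ (Fin 1) => y (n + 1) 0 := by fun_prop
    exact ih.min this

theorem measurable_runMax (n : ℕ) : Measurable fun y => runMax y n := by
  induction n with
  | zero => unfold runMax; fun_prop
  | succ n ih =>
    have : Measurable fun y : ℕ → EuclideanSpace ℝ (Fin 1) => y (n + 1) 0 := by fun_prop
    exact ih.max this

theorem tendsto_runMin (hy : ∀ i, y i ∈ openCube 1)
    (h : ∀ m : ℕ, ∃ i, y i 0 < 1 / ((m : ℝ) + 1)) : Tendsto (runMin y) atTop (𝓝 0) := by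
  rw [tendsto_order]
  refine ⟨fun b hb => Eventually.of_forall fun n => ?_, fun ε hε => ?_⟩
  · obtain ⟨j, _, hj⟩ := exists_eq_runMin y n
    rw [← hj]
    exact hb.trans (hy j 0).1
  · obtain ⟨m, hm⟩ := exists_nat_one_div_lt hε
    obtain ⟨i, hi⟩ := h m
    filter_upwards [eventually_ge_atTop i] with n hn
    exact (runMin_le y n i hn).trans_lt (hi.trans hm)

theorem tendsto_one_sub_runMax (hy : ∀ i, y i ∈ openCube 1)
    (h : ∀ m : ℕ, ∃ i, 1 - y i 0 < 1 / ((m : ℝ) + 1)) :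
    Tendsto (fun n => 1 - runMax y n) atTop (𝓝 0) := by
  rw [tendsto_order]
  refine ⟨fun b hb => Eventually.of_forall fun n => ?_, fun ε hε => ?_⟩
  · obtain ⟨j, _, hj⟩ := exists_eq_runMax y n
    rw [← hj]
    linarith [(hy j 0).2]
  · obtain ⟨m, hm⟩ := exists_nat_one_div_lt hε
    obtain ⟨i, hi⟩ := h m
    filter_upwards [eventually_ge_atTop i] with n hn
    linarith [le_runMax y n i hn]

/-- The case k = 0 of `measurePreserving_appendLast`, whose zero-dimensional factor has mass 1. -/
theorem measurePreserving_apply_zero :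
    MeasurePreserving (fun x : EuclideanSpace ℝ (Fin 1) => x 0) (uniformCube 1) uniform01 := by
  have h := measurePreserving_appendLast 0
  have hm : Measurable fun x : EuclideanSpace ℝ (Fin 1) => x 0 := by fun_prop
  refine ⟨hm, ?_⟩
  rw [← h.map_eq, Measure.map_map hm h.measurable]
  have : (fun x : EuclideanSpace ℝ (Fin 1) => x 0) ∘ appendLast =
      (Prod.snd : EuclideanSpace ℝ (Fin 0) × ℝ → ℝ) := by
    funext p
    exact appendLast_last p
  rw [this]
  exact measurePreserving_snd.map_eq

theorem ae_tendsto_runMin_runMax : ∀ᵐ y ∂uniformSeq 1,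
    Tendsto (runMin y) atTop (𝓝 0) ∧ Tendsto (fun n => 1 - runMax y n) atTop (𝓝 0) := by
  have hm : Measurable fun x : EuclideanSpace ℝ (Fin 1) => x 0 := by fun_prop
  -- Every open set meeting (0,1) is almost surely visited; neighbourhoods of 0 and 1 drive the
  -- extremes to the endpoints.
  have key : ∀ s : Set ℝ, IsOpen s → (s ∩ Set.Ioo (0 : ℝ) 1).Nonempty →
      ∀ᵐ y ∂uniformSeq 1, ∃ i, y i 0 ∈ s := by
    intro s hs hne
    refine ae_exists_mem_infinitePi (uniformCube 1) (s := (fun x => x 0) ⁻¹' s)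
      (hm hs.measurableSet) ?_
    rw [measurePreserving_apply_zero.measure_preimage hs.measurableSet.nullMeasurableSet,
      uniform01, Measure.restrict_apply hs.measurableSet]
    exact ((hs.inter isOpen_Ioo).measure_pos _ hne).ne'
  have h1 : ∀ᵐ y ∂uniformSeq 1, ∀ m : ℕ, ∃ i, y i 0 < 1 / ((m : ℝ) + 1) := by
    rw [ae_all_iff]
    intro m
    have hpos : (0 : ℝ) < 1 / ((m : ℝ) + 1) := by positivity
    refine key (Set.Iio (1 / ((m : ℝ) + 1))) isOpen_Iio
      ⟨min (1 / ((m : ℝ) + 1)) 1 / 2, ?_, ?_, ?_⟩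
    · simp only [Set.mem_Iio]
      linarith [min_le_left (1 / ((m : ℝ) + 1)) 1]
    · positivity
    · linarith [min_le_right (1 / ((m : ℝ) + 1)) 1]
  have h2 : ∀ᵐ y ∂uniformSeq 1, ∀ m : ℕ, ∃ i, 1 - y i 0 < 1 / ((m : ℝ) + 1) := by
    rw [ae_all_iff]
    intro m
    have hpos : (0 : ℝ) < 1 / ((m : ℝ) + 1) := by positivity
    have := key (Set.Ioi (1 - 1 / ((m : ℝ) + 1))) isOpen_Ioi
      ⟨1 - min (1 / ((m : ℝ) + 1)) 1 / 2, ?_, ?_, ?_⟩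
    · filter_upwards [this] with y hy
      obtain ⟨i, hi⟩ := hy
      exact ⟨i, by simp only [Set.mem_Ioi] at hi; linarith⟩
    · simp only [Set.mem_Ioi]
      linarith [min_le_left (1 / ((m : ℝ) + 1)) 1]
    · linarith [min_le_right (1 / ((m : ℝ) + 1)) 1]
    · have : 0 < min (1 / ((m : ℝ) + 1)) 1 / 2 := by positivity
      linarith
  filter_upwards [h1, h2, ae_uniformSeq_mem_openCube 1] with y hy1 hy2 hy
  exact ⟨tendsto_runMin hy hy1, tendsto_one_sub_runMax hy hy2⟩

end Records


/-! ### The record martingale and the limit law in dimension one -/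

section RecordMartingale

variable {D : ProbabilityMeasure ℝ} {t : ℝ}

/-- The probability that `s * M ≤ t` when `M` has law `D`. -/
noncomputable def scaledCdf (D : ProbabilityMeasure ℝ) (t s : ℝ) : ℝ :=
  (D : Measure ℝ).real {m | s * m ≤ t}

theorem measurableSet_scaled (t s : ℝ) : MeasurableSet {m : ℝ | s * m ≤ t} :=
  measurableSet_le (by fun_prop) measurable_const

theorem scaledCdf_nonneg (s : ℝ) : 0 ≤ scaledCdf D t s := measureReal_nonneg

theorem scaledCdf_le_one (s : ℝ) : scaledCdf D t s ≤ 1 := measureReal_le_one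

theorem abs_scaledCdf_le_one (s : ℝ) : |scaledCdf D t s| ≤ 1 := by
  rw [abs_of_nonneg (scaledCdf_nonneg s)]
  exact scaledCdf_le_one s

theorem measurable_scaledCdf (D : ProbabilityMeasure ℝ) (t : ℝ) : Measurable (scaledCdf D t) := by
  have h : MeasurableSet {p : ℝ × ℝ | p.1 * p.2 ≤ t} :=
    measurableSet_le (by fun_prop) measurable_const
  exact (measurable_measure_prodMk_left (ν := (D : Measure ℝ)) h).ennreal_toReal

/-- For each m the product s m tends to 0, which is strictly below t; at t = 0 this argument would
fail. -/
theorem tendsto_scaledCdf (ht : 0 < t) {s : ℕ → ℝ} (hs : Tendsto s atTop (𝓝 0)) :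
    Tendsto (fun n => scaledCdf D t (s n)) atTop (𝓝 1) := by
  have h1 : ∀ s, scaledCdf D t s = ∫ m, {m : ℝ | s * m ≤ t}.indicator (fun _ => (1 : ℝ)) m
      ∂(D : Measure ℝ) := fun s => by
    rw [integral_indicator_const _ (measurableSet_scaled t s)]
    simp [scaledCdf]
  have h2 : (1 : ℝ) = ∫ _m, (1 : ℝ) ∂(D : Measure ℝ) := by simp
  simp only [h1]
  suffices h : Tendsto (fun n => ∫ m, {m : ℝ | s n * m ≤ t}.indicator (fun _ => (1 : ℝ)) m
      ∂(D : Measure ℝ)) atTop (𝓝 (∫ _m, (1 : ℝ) ∂(D : Measure ℝ))) by rwa [← h2] at h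
  refine tendsto_integral_of_dominated_convergence (fun _ => 1) (fun n =>
    (measurable_const.indicator (measurableSet_scaled t _)).aestronglyMeasurable)
    (integrable_const _) (fun n => Eventually.of_forall fun m => ?_)
    (Eventually.of_forall fun m => ?_)
  · by_cases h : m ∈ {m : ℝ | s n * m ≤ t} <;> simp [h]
  · have h3 : Tendsto (fun n => s n * m) atTop (𝓝 0) := by simpa using hs.mul_const m
    refine tendsto_const_nhds.congr' ?_
    filter_upwards [h3.eventually_lt_const ht] with n hn
    rw [Set.indicator_of_mem]
    exact hn.le

/-- The integral equation for the rescaled max-Dickman distribution function. -/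
theorem IsMaxDickman.integral_scaledCdf (hD : IsMaxDickman D) {s : ℝ} (hs : 0 ≤ s) :
    ∫ w in (0 : ℝ)..s, (if s - w ≤ t then scaledCdf D t w else 0) = s * scaledCdf D t s := by
  -- Conditioning on U = u in the fixed-point equation: s max{1 - u, u m} ≤ t splits into s - s u ≤
  -- t and s u m ≤ t. The substitution w = s u follows, in a form also valid for s = 0.
  have h1 : scaledCdf D t s =
      ∫ u in (0 : ℝ)..1, (if s - s * u ≤ t then scaledCdf D t (s * u) else 0) := by
    have hmp := hD.measurePreserving_dickmanStep
    have hset : MeasurableSet (dickmanStep ⁻¹' {m | s * m ≤ t}) :=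
      hmp.measurable (measurableSet_scaled t s)
    rw [scaledCdf, ← hmp.measureReal_preimage (measurableSet_scaled t s).nullMeasurableSet,
      ← integral_uniform01, ← setIntegral_one_eq_measureReal, ← integral_indicator hset,
      integral_prod _ ((integrable_const 1).indicator hset)]
    congr 1
    ext u
    have hslice : ∀ m, (dickmanStep ⁻¹' {m | s * m ≤ t}).indicator (fun _ => (1 : ℝ)) (u, m) =
        if s - s * u ≤ t then {m : ℝ | s * u * m ≤ t}.indicator (fun _ => (1 : ℝ)) m else 0 := by
      intro m
      have : (u, m) ∈ dickmanStep ⁻¹' {m | s * m ≤ t} ↔ s - s * u ≤ t ∧ s * u * m ≤ t := by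
        simp only [Set.mem_preimage, dickmanStep, Set.mem_ofPred_eq, mul_max_of_nonneg _ _ hs,
          max_le_iff, mul_sub, mul_one, mul_assoc]
      by_cases h : (u, m) ∈ dickmanStep ⁻¹' {m | s * m ≤ t}
      · rw [Set.indicator_of_mem h, if_pos (this.1 h).1,
          Set.indicator_of_mem (show m ∈ {m : ℝ | s * u * m ≤ t} from (this.1 h).2)]
      · rw [Set.indicator_of_notMem h]
        split_ifs with h1
        · rw [Set.indicator_of_notMem (show m ∉ {m : ℝ | s * u * m ≤ t} from
            fun h2 => h (this.2 ⟨h1, h2⟩))]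
        · rfl
    simp only [hslice]
    split_ifs with h
    · rw [integral_indicator_const _ (measurableSet_scaled t _)]
      simp [scaledCdf]
    · simp
  rw [h1]
  have := intervalIntegral.smul_integral_comp_mul_left (a := 0) (b := 1)
    (fun w => if s - w ≤ t then scaledCdf D t w else 0) s
  rw [mul_zero, mul_one, smul_eq_mul] at this
  exact this.symm

theorem intervalIntegrable_of_measurable_bounded {g : ℝ → ℝ} (hg : Measurable g)
    (hb : ∀ x, |g x| ≤ 1) (a b : ℝ) : IntervalIntegrable g volume a b := by
  refine (intervalIntegrable_const (c := (1 : ℝ))).mono_fun hg.aestronglyMeasurable ?_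
  exact Eventually.of_forall fun x => by simpa using hb x

theorem measurable_recordStep (D : ProbabilityMeasure ℝ) (t a b : ℝ) :
    Measurable fun u => if a - u ≤ t ∧ u - b ≤ t then
      scaledCdf D t (min a u) * scaledCdf D t (1 - max b u) else 0 := by
  have h1 : Measurable fun u => min a u := by fun_prop
  have h2 : Measurable fun u => 1 - max b u := by fun_prop
  have hH := measurable_scaledCdf D t
  refine Measurable.ite ?_ ((hH.comp h1).mul (hH.comp h2)) measurable_const
  have h3 : MeasurableSet {u : ℝ | a - u ≤ t} := measurableSet_le (by fun_prop) measurable_const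
  have h4 : MeasurableSet {u : ℝ | u - b ≤ t} := measurableSet_le (by fun_prop) measurable_const
  exact h3.inter h4

/-- One step of the record chain leaves the product of rescaled distribution functions invariant
in mean. -/
theorem IsMaxDickman.integral_step (hD : IsMaxDickman D) (ht : 0 ≤ t) {a b : ℝ} (ha : 0 ≤ a)
    (hab : a ≤ b) (hb : b ≤ 1) :
    ∫ u in (0 : ℝ)..1, (if a - u ≤ t ∧ u - b ≤ t then
      scaledCdf D t (min a u) * scaledCdf D t (1 - max b u) else 0) =
      scaledCdf D t a * scaledCdf D t (1 - b) := by
  set H := scaledCdf D t with hH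
  set G : ℝ → ℝ := fun u => if a - u ≤ t ∧ u - b ≤ t then H (min a u) * H (1 - max b u) else 0
    with hG
  have hGm : Measurable G := measurable_recordStep D t a b
  have hGb : ∀ x, |G x| ≤ 1 := by
    intro x
    simp only [hG]
    split_ifs
    · rw [abs_mul]
      exact mul_le_one₀ (abs_scaledCdf_le_one _) (abs_nonneg _) (abs_scaledCdf_le_one _)
    · simp
  have hGi := intervalIntegrable_of_measurable_bounded hGm hGb
  -- The cases are a new minimum, no record and a new maximum. By the integral equation, its
  -- reflected form on the right, they contribute the target with weights a, b - a and 1 - b.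
  rw [← intervalIntegral.integral_add_adjacent_intervals (hGi 0 a) (hGi a 1),
    ← intervalIntegral.integral_add_adjacent_intervals (hGi a b) (hGi b 1)]
  have e1 : ∫ u in (0 : ℝ)..a, G u = a * H a * H (1 - b) := by
    rw [← hD.integral_scaledCdf ha, ← intervalIntegral.integral_mul_const]
    refine intervalIntegral.integral_congr fun u hu => ?_
    rw [Set.uIcc_of_le ha] at hu
    have h2 : u - b ≤ t := by linarith [hu.2]
    simp only [hG, h2, and_true, min_eq_right hu.2, max_eq_left (hu.2.trans hab)]
    split_ifs <;> simp [hH]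
  have e2 : ∫ u in a..b, G u = (b - a) * (H a * H (1 - b)) := by
    rw [← smul_eq_mul, ← intervalIntegral.integral_const]
    refine intervalIntegral.integral_congr fun u hu => ?_
    rw [Set.uIcc_of_le hab] at hu
    have h1 : a - u ≤ t := by linarith [hu.1]
    have h2 : u - b ≤ t := by linarith [hu.2]
    simp only [hG, h1, h2, and_true, if_true, min_eq_left hu.1, max_eq_left hu.2]
  have e3 : ∫ u in b..1, G u = H a * ((1 - b) * H (1 - b)) := by
    rw [← hD.integral_scaledCdf (sub_nonneg.2 hb), ← intervalIntegral.integral_const_mul]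
    have := intervalIntegral.integral_comp_sub_left (a := b) (b := 1)
      (fun w => H a * if 1 - b - w ≤ t then H w else 0) 1
    rw [sub_self] at this
    rw [← this]
    refine intervalIntegral.integral_congr fun u hu => ?_
    rw [Set.uIcc_of_le hb] at hu
    have h1 : a - u ≤ t := by linarith [hu.1]
    have h3 : 1 - b - (1 - u) = u - b := by ring
    simp only [hG, h1, true_and, min_eq_left (hab.trans hu.1), max_eq_right hu.1, h3]
    split_ifs <;> simp [hH]
  rw [e1, e2, e3]
  ring

open scoped Classical in
/-- The conditional probability that no edge ever exceeds `t`, given the first `n + 1` points. -/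
noncomputable def recordMartingale (D : ProbabilityMeasure ℝ) (t : ℝ) (n : ℕ)
    (y : ℕ → EuclideanSpace ℝ (Fin 1)) : ℝ :=
  if ongLongestEdge y (n + 1) ≤ t then
    scaledCdf D t (runMin y n) * scaledCdf D t (1 - runMax y n) else 0

theorem measurable_recordMartingale (D : ProbabilityMeasure ℝ) (t : ℝ) (n : ℕ) :
    Measurable (recordMartingale D t n) := by
  refine Measurable.ite (measurableSet_le (measurable_ongLongestEdge _) measurable_const)
    (((measurable_scaledCdf D t).comp (measurable_runMin n)).mul
      ((measurable_scaledCdf D t).comp (measurable_const.sub (measurable_runMax n))))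
    measurable_const

theorem abs_recordMartingale_le_one (n : ℕ) (y : ℕ → EuclideanSpace ℝ (Fin 1)) :
    |recordMartingale D t n y| ≤ 1 := by
  unfold recordMartingale
  split_ifs
  · rw [abs_mul]
    exact mul_le_one₀ (abs_scaledCdf_le_one _) (abs_nonneg _) (abs_scaledCdf_le_one _)
  · simp

theorem recordMartingale_update (ht : 0 ≤ t) (n : ℕ) (y : ℕ → EuclideanSpace ℝ (Fin 1))
    (z : EuclideanSpace ℝ (Fin 1)) :
    recordMartingale D t (n + 1) (Function.update y (n + 1) z) =
      if ongLongestEdge y (n + 1) ≤ t then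
        (if runMin y n - z 0 ≤ t ∧ z 0 - runMax y n ≤ t then
          scaledCdf D t (min (runMin y n) (z 0)) * scaledCdf D t (1 - max (runMax y n) (z 0))
        else 0) else 0 := by
  set y' := Function.update y (n + 1) z with hy'
  have hne : ∀ j, j ≠ n + 1 → y' j = y j := fun j hj => Function.update_of_ne hj _ _
  have h0 : y' (n + 1) = z := Function.update_self _ _ _
  have h1 : ongLongestEdge y' (n + 1) = ongLongestEdge y (n + 1) :=
    ongLongestEdge_congr fun j hj => hne j hj.ne
  have h2 : runMin y' n = runMin y n := runMin_congr fun j hj => hne j (by omega)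
  have h3 : runMax y' n = runMax y n := runMax_congr fun j hj => hne j (by omega)
  simp only [recordMartingale, ongLongestEdge_succ_succ_le_iff y' n ht, runMin, runMax, h0, h1,
    h2, h3, ite_and]

theorem runMin_runMax_mem {y : ℕ → EuclideanSpace ℝ (Fin 1)} (hy : ∀ i, y i ∈ openCube 1) (n : ℕ) :
    0 ≤ runMin y n ∧ runMax y n ≤ 1 := by
  obtain ⟨i, _, hi⟩ := exists_eq_runMin y n
  obtain ⟨j, _, hj⟩ := exists_eq_runMax y n
  rw [← hi, ← hj]
  exact ⟨(hy i 0).1.le, (hy j 0).2.le⟩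

theorem integral_uniformCube_one {g : ℝ → ℝ} (hg : Measurable g) :
    ∫ z, g (z 0) ∂uniformCube 1 = ∫ u in (0 : ℝ)..1, g u := by
  rw [← integral_uniform01, ← measurePreserving_apply_zero.map_eq,
    integral_map measurePreserving_apply_zero.measurable.aemeasurable hg.aestronglyMeasurable]

/-- Resampling the point of index n + 1 preserves the law of the sequence. Integrating that point
out, with the earlier ones fixed, is exactly one record step. -/
theorem IsMaxDickman.integral_recordMartingale_succ (hD : IsMaxDickman D) (ht : 0 ≤ t) (n : ℕ) :
    ∫ y, recordMartingale D t (n + 1) y ∂uniformSeq 1 =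
      ∫ y, recordMartingale D t n y ∂uniformSeq 1 := by
  have hmp := measurePreserving_update_infinitePi (uniformCube 1) (n + 1)
  have hm := measurable_recordMartingale D t (n + 1)
  have h1 : ∫ y, recordMartingale D t (n + 1) y ∂uniformSeq 1 =
      ∫ y, ∫ z, recordMartingale D t (n + 1) (Function.update y (n + 1) z)
        ∂uniformCube 1 ∂uniformSeq 1 := by
    conv_lhs => rw [uniformSeq, ← hmp.map_eq]
    rw [integral_map hmp.measurable.aemeasurable hm.aestronglyMeasurable]
    exact integral_prod _ ((integrable_const (1 : ℝ)).mono'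
      (hm.comp hmp.measurable).aestronglyMeasurable
      (Eventually.of_forall fun p => abs_recordMartingale_le_one _ _))
  rw [h1]
  refine integral_congr_ae ?_
  filter_upwards [ae_uniformSeq_mem_openCube 1] with y hy
  simp only [recordMartingale_update ht]
  obtain ⟨ha, hb⟩ := runMin_runMax_mem hy n
  rw [recordMartingale]
  split_ifs with hO
  · rw [← hD.integral_step ht ha (runMin_le_runMax y n) hb]
    refine integral_uniformCube_one (g := fun u => if runMin y n - u ≤ t ∧ u - runMax y n ≤ t then
      scaledCdf D t (min (runMin y n) u) * scaledCdf D t (1 - max (runMax y n) u) else 0) ?_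
    exact measurable_recordStep D t _ _
  · simp

/-- The law of `max {U M₁, (1 - U) M₂}`, where `M₁` and `M₂` have law `D`. -/
noncomputable def splitMaxLaw (D : ProbabilityMeasure ℝ) : Measure ℝ :=
  (uniform01.prod ((D : Measure ℝ).prod (D : Measure ℝ))).map
    (fun p : ℝ × ℝ × ℝ => max (p.1 * p.2.1) ((1 - p.1) * p.2.2))

theorem measurable_splitMax :
    Measurable fun p : ℝ × ℝ × ℝ => max (p.1 * p.2.1) ((1 - p.1) * p.2.2) := by
  fun_prop

instance isProbabilityMeasure_splitMaxLaw (D : ProbabilityMeasure ℝ) :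
    IsProbabilityMeasure (splitMaxLaw D) :=
  Measure.isProbabilityMeasure_map measurable_splitMax.aemeasurable

/-- Given U = u, the bound on the maximum is one constraint on each of the independent M₁ and M₂. -/
theorem splitMaxLaw_real_Iic (D : ProbabilityMeasure ℝ) (t : ℝ) :
    (splitMaxLaw D).real (Set.Iic t) =
      ∫ u in (0 : ℝ)..1, scaledCdf D t u * scaledCdf D t (1 - u) := by
  have hset := measurable_splitMax (measurableSet_Iic (a := t))
  rw [splitMaxLaw, map_measureReal_apply measurable_splitMax measurableSet_Iic,
    ← integral_uniform01, ← setIntegral_one_eq_measureReal, ← integral_indicator hset,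
    integral_prod _ ((integrable_const 1).indicator hset)]
  congr 1
  ext u
  have h1 : MeasurableSet ({m : ℝ | u * m ≤ t} ×ˢ {m : ℝ | (1 - u) * m ≤ t}) :=
    (measurableSet_scaled t u).prod (measurableSet_scaled t (1 - u))
  have h2 : ∀ q : ℝ × ℝ, ((fun p : ℝ × ℝ × ℝ => max (p.1 * p.2.1) ((1 - p.1) * p.2.2)) ⁻¹'
      Set.Iic t).indicator (fun _ => (1 : ℝ)) (u, q) =
      ({m : ℝ | u * m ≤ t} ×ˢ {m : ℝ | (1 - u) * m ≤ t}).indicator (fun _ => (1 : ℝ)) q := by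
    intro q
    have : (u, q) ∈ ((fun p : ℝ × ℝ × ℝ => max (p.1 * p.2.1) ((1 - p.1) * p.2.2)) ⁻¹'
      Set.Iic t) ↔ q ∈ ({m : ℝ | u * m ≤ t} ×ˢ {m : ℝ | (1 - u) * m ≤ t}) := by
      simp
    by_cases h : q ∈ {m : ℝ | u * m ≤ t} ×ˢ {m : ℝ | (1 - u) * m ≤ t}
    · rw [Set.indicator_of_mem h, Set.indicator_of_mem (this.2 h)]
    · rw [Set.indicator_of_notMem h, Set.indicator_of_notMem fun h' => h (this.1 h')]
  simp only [h2]
  rw [integral_indicator_const _ h1, smul_eq_mul, mul_one, measureReal_prod_prod]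
  rfl

/-- With one point there is no edge, and the minimum and maximum coincide with a uniform variable.
-/
theorem integral_recordMartingale_zero (ht : 0 ≤ t) :
    ∫ y, recordMartingale D t 0 y ∂uniformSeq 1 = (splitMaxLaw D).real (Set.Iic t) := by
  have h0 : ∀ y : ℕ → EuclideanSpace ℝ (Fin 1), recordMartingale D t 0 y =
      scaledCdf D t (y 0 0) * scaledCdf D t (1 - y 0 0) := by
    intro y
    have : ongLongestEdge y (0 + 1) ≤ t := by
      rw [ongLongestEdge_le_iff y _ ht]
      intro i hi hi0
      omega
    rw [recordMartingale, if_pos this]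
    rfl
  have hm : Measurable fun u => scaledCdf D t u * scaledCdf D t (1 - u) :=
    (measurable_scaledCdf D t).mul ((measurable_scaledCdf D t).comp (by fun_prop))
  have hm0 : Measurable fun x : EuclideanSpace ℝ (Fin 1) => x 0 := by fun_prop
  simp only [h0]
  rw [splitMaxLaw_real_Iic, ← integral_uniformCube_one hm]
  have hmp := measurePreserving_eval_infinitePi (fun _ : ℕ => uniformCube 1) 0
  conv_rhs => rw [← hmp.map_eq]
  exact (integral_map hmp.measurable.aemeasurable (hm.comp hm0).aestronglyMeasurable).symm

/-- If the supremum is at most t, both factors tend to 1 because the extremes reach the endpoints;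
otherwise an edge eventually exceeds t and the value stays 0. -/
theorem tendsto_recordMartingale (ht : 0 < t) : ∀ᵐ y ∂uniformSeq 1,
    Tendsto (fun n => recordMartingale D t n y) atTop
      (𝓝 ((ongSup ⁻¹' Set.Iic t).indicator (fun _ => (1 : ℝ)) y)) := by
  filter_upwards [ae_uniformSeq_mem_openCube 1, ae_tendsto_runMin_runMax] with y hy hlim
  have hO := tendsto_ongLongestEdge hy
  by_cases h : ongSup y ≤ t
  · rw [Set.indicator_of_mem (show y ∈ ongSup ⁻¹' Set.Iic t from h)]
    have h1 : ∀ n, ongLongestEdge y (n + 1) ≤ t := fun n =>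
      (le_ciSup (bddAbove_ongLongestEdge hy) (n + 1)).trans h
    simp only [recordMartingale, h1, if_true]
    simpa using (tendsto_scaledCdf ht hlim.1).mul (tendsto_scaledCdf ht hlim.2)
  · rw [Set.indicator_of_notMem (show y ∉ ongSup ⁻¹' Set.Iic t from h)]
    refine tendsto_const_nhds.congr' ?_
    filter_upwards [(hO.comp (tendsto_add_atTop_nat 1)).eventually_const_lt (not_le.1 h)] with n hn
    exact (if_neg (not_le.2 hn)).symm

/-- The mean is constant in n: its initial value gives the right-hand side, its limit the left-hand
side. -/
theorem IsMaxDickman.ongSupLaw_real_Iic (hD : IsMaxDickman D) (ht : 0 < t) :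
    (ongSupLaw 1 : Measure ℝ).real (Set.Iic t) = (splitMaxLaw D).real (Set.Iic t) := by
  have hconst : ∀ n, ∫ y, recordMartingale D t n y ∂uniformSeq 1 =
      (splitMaxLaw D).real (Set.Iic t) := by
    intro n
    induction n with
    | zero => exact integral_recordMartingale_zero ht.le
    | succ n ih => rw [hD.integral_recordMartingale_succ ht.le, ih]
  have hlim : Tendsto (fun n => ∫ y, recordMartingale D t n y ∂uniformSeq 1) atTop
      (𝓝 (∫ y, (ongSup ⁻¹' Set.Iic t).indicator (fun _ => (1 : ℝ)) y ∂uniformSeq 1)) :=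
    tendsto_integral_of_dominated_convergence (fun _ => 1)
      (fun n => (measurable_recordMartingale D t n).aestronglyMeasurable) (integrable_const _)
      (fun n => Eventually.of_forall fun y => abs_recordMartingale_le_one n y)
      (tendsto_recordMartingale ht)
  simp only [hconst] at hlim
  rw [tendsto_nhds_unique tendsto_const_nhds hlim,
    integral_indicator_const _ (measurable_ongSup 1 measurableSet_Iic), ongSupLaw,
    ProbabilityMeasure.coe_mk, map_measureReal_apply (measurable_ongSup 1) measurableSet_Iic]
  simp

theorem IsMaxDickman.ae_nonneg (hD : IsMaxDickman D) : ∀ᵐ m ∂(D : Measure ℝ), 0 ≤ m := by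
  have hmp := hD.measurePreserving_dickmanStep
  rw [← hmp.map_eq, ae_map_iff hmp.measurable.aemeasurable measurableSet_Ici]
  filter_upwards [Measure.quasiMeasurePreserving_fst.ae ae_uniform01_mem] with p hp
  exact le_max_of_le_left (by linarith [hp.2])

theorem ongSup_nonneg {k : ℕ} (y : ℕ → EuclideanSpace ℝ (Fin k)) : 0 ≤ ongSup y :=
  Real.iSup_nonneg fun n => ongLongestEdge_nonneg y n

/-- In dimension one the supremum of the edge lengths of the on-line nearest-neighbour graph is
distributed as `max {U M₁, (1 - U) M₂}`. -/
theorem IsMaxDickman.ongSupLaw_eq (hD : IsMaxDickman D) :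
    (ongSupLaw 1 : Measure ℝ) = splitMaxLaw D := by
  have hpos : ∀ t, 0 < t → (ongSupLaw 1 : Measure ℝ) (Set.Iic t) = splitMaxLaw D (Set.Iic t) :=
    fun t ht => (measureReal_eq_measureReal_iff).1 (hD.ongSupLaw_real_Iic ht)
  refine Measure.ext_of_Iic _ _ fun t => ?_
  -- The martingale argument covers t > 0. Both laws are carried by the nonnegative numbers, which
  -- settles t < 0, and t = 0 follows by right continuity.
  rcases lt_trichotomy t 0 with ht | rfl | ht
  · have h1 : (ongSupLaw 1 : Measure ℝ) (Set.Iic t) = 0 := by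
      rw [ongSupLaw, ProbabilityMeasure.coe_mk, Measure.map_apply (measurable_ongSup 1)
        measurableSet_Iic]
      convert measure_empty (μ := uniformSeq 1)
      ext y
      simpa using ht.trans_le (ongSup_nonneg y)
    have h2 : splitMaxLaw D (Set.Iic t) = 0 := by
      rw [splitMaxLaw, Measure.map_apply measurable_splitMax measurableSet_Iic]
      refine measure_mono_null (t := {p : ℝ × ℝ × ℝ | ¬ (p.1 ∈ Set.Ioo (0 : ℝ) 1 ∧ 0 ≤ p.2.1)}) ?_
        ?_
      · rintro p hp ⟨h1, h2⟩
        have : p.1 * p.2.1 ≤ t := (le_max_left _ _).trans (Set.mem_Iic.1 hp)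
        have := mul_nonneg h1.1.le h2
        linarith
      · rw [← ae_iff]
        exact (Measure.quasiMeasurePreserving_fst.ae ae_uniform01_mem).and
          (Measure.quasiMeasurePreserving_snd.ae (Measure.quasiMeasurePreserving_fst.ae hD.ae_nonneg))
    rw [h1, h2]
  · have hI : Set.Iic (0 : ℝ) = ⋂ n : ℕ, Set.Iic (1 / ((n : ℝ) + 1)) := by
      ext x
      simp only [Set.mem_Iic, Set.mem_iInter]
      refine ⟨fun h n => h.trans (by positivity), fun h => ?_⟩
      exact ge_of_tendsto' (tendsto_one_div_add_atTop_nhds_zero_nat (𝕜 := ℝ)) h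
    have hanti : Antitone fun n : ℕ => Set.Iic (1 / ((n : ℝ) + 1)) := fun m n hmn =>
      Set.Iic_subset_Iic.2 (Nat.one_div_le_one_div hmn)
    have hl : ∀ ν : Measure ℝ, IsProbabilityMeasure ν →
        Tendsto (fun n : ℕ => ν (Set.Iic (1 / ((n : ℝ) + 1)))) atTop (𝓝 (ν (Set.Iic 0))) := by
      intro ν _
      rw [hI]
      exact tendsto_measure_iInter_atTop (fun n => measurableSet_Iic.nullMeasurableSet) hanti
        ⟨0, measure_ne_top _ _⟩
    refine tendsto_nhds_unique (hl _ inferInstance) ((hl (splitMaxLaw D) inferInstance).congr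
      fun n => ?_)
    exact (hpos _ (by positivity)).symm
  · exact hpos t ht

end RecordMartingale

end SouthMDST

open SouthMDST in
/-- The ambient dimension is `k + 1 ≥ 2`, and `Q` is the law of `Q_max(k)`. -/
theorem theorem3 (k : ℕ) (hk : 1 ≤ k) :
    ∃ Q : ProbabilityMeasure ℝ,
      -- the longest edge of the South MDST on a Poisson process in `(0,1)^(k+1)`, as the
      -- intensity tends to infinity
      (∀ {ι : Type*} (l : Filter ι) (r : ι → ℝ≥0), Tendsto r l atTop →
        ∀ {Ω : ι → Type*} [∀ i, MeasurableSpace (Ω i)] (μ : ∀ i, Measure (Ω i))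
          [∀ i, IsProbabilityMeasure (μ i)]
          (P : ∀ i, Ω i → Finset (EuclideanSpace ℝ (Fin (k + 1)))),
          (∀ i, IsPoissonProcess (r i) (P i) (μ i)) →
            TendstoInDistribution (fun i ω => southLongestEdge (P i ω)) l
              (fun q : ℝ => q) μ (Q : Measure ℝ)) ∧
      -- the longest edge of the ONG on `n` independent uniform points in `(0,1)^k`
      (∀ {Ω : Type*} [MeasurableSpace Ω] (μ : Measure Ω) [IsProbabilityMeasure μ]
          (U : ℕ → Ω → EuclideanSpace ℝ (Fin k)),
          (∀ j, HasLaw (U j) (uniformCube k) μ) → iIndepFun U μ →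
            TendstoInDistribution (fun (n : ℕ) ω => ongLongestEdge (fun j => U j ω) n) atTop
              (fun q : ℝ => q) (fun _ => μ) (Q : Measure ℝ)) ∧
      -- the longest edge of the ONG on a Poisson number of independent uniform points
      (∀ {ι : Type*} (l : Filter ι) (r : ι → ℝ≥0), Tendsto r l atTop →
        ∀ {Ω : Type*} [MeasurableSpace Ω] (μ : Measure Ω) [IsProbabilityMeasure μ]
          (U : ℕ → Ω → EuclideanSpace ℝ (Fin k)) (N : ι → Ω → ℕ),
          (∀ j, HasLaw (U j) (uniformCube k) μ) → iIndepFun U μ →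
          (∀ i, HasLaw (N i) (poissonMeasure (r i)) μ) →
          (∀ i, IndepFun (N i) (fun ω j => U j ω) μ) →
            TendstoInDistribution (fun i ω => ongLongestEdge (fun j => U j ω) (N i ω)) l
              (fun q : ℝ => q) (fun _ => μ) (Q : Measure ℝ)) ∧
      -- ambient dimension two: `Q` is the law of `max {U M₁, (1 - U) M₂}`
      (k = 1 →
        (∃! D : ProbabilityMeasure ℝ, IsMaxDickman D) ∧
        ∀ D : ProbabilityMeasure ℝ, IsMaxDickman D →
          (Q : Measure ℝ) =
            (uniform01.prod ((D : Measure ℝ).prod (D : Measure ℝ))).map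
              (fun p : ℝ × ℝ × ℝ => max (p.1 * p.2.1) ((1 - p.1) * p.2.2))) := by
  refine ⟨ongSupLaw k, fun l r hr _ _ μ _ P hP => tendstoInDistribution_southLongestEdge l r hr μ P hP,
    fun μ _ U hU hind => tendstoInDistribution_ongLongestEdge μ U hU hind,
    fun l r hr _ _ μ _ U N hU hind hN hNU =>
      tendstoInDistribution_ongLongestEdge_poisson l r hr μ U N hU hind hN hNU, ?_⟩
  rintro rfl
  exact ⟨existsUnique_isMaxDickman, fun D hD => hD.ongSupLaw_eq⟩
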